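/- Let $M$ be a connected, smooth ($C^\infty$, Hausdorff, second countable) manifold of dimension $n\ge 1$, and let $F:TM\to[0,\infty)$ be a Finsler metric on $M$: $F$ is continuous, smooth on $TM\setminus\{0\}$, satisfies $F(x,ty)=tF(x,y)$ for all $t\ge 0$, and the matrix $g_{ij}(x,y)=\big[\tfrac12F^2(x,y)\big]_{y^iy^j}$ is positive definite for every $(x,y)\in TM\setminus\{0\}$. Assume that $(M,F)$ is complete, i.e. every constant speed geodesic $\sigma:[0,a]\to M$ of $F$ (with $a>0$) extends to a geodesic on $[0,\infty)$ and to a geodesic on $(-\infty,a]$, and that its reversibility constant is finite: $$r_F=\sup_{x\in M}\ \sup_{y\in T_xM\setminus\{0\}}\frac{F(x,y)}{F(x,-y)}<+\infty .$$ Let $\mathsf m$ be the Hausdorff volume of $(M,F)$, given in local coordinates by $\mathrm d\mathsf m(x)=\frac{\omega_n}{\mathrm{Vol}(B_x(1))}\,\mathrm dx^1\cdots\mathrm dx^n$, where $B_x(1)=\{(y^i)\in\mathbb R^n: F(x,y^i\partial/\partial x^i)<1\}$, $\mathrm{Vol}$ is Lebesgue measure and $\omega_n$ is the volume of the Euclidean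 unit ball of $\mathbb R^n$. Let $$F_s(x,y)=\Big(\frac{F^2(x,y)+F^2(x,-y)}2\Big)^{1/2}.$$ For $G\in\{F,F_s\}$, $x\in M$ and $\alpha\in T_x^*M$ put $G^*(x,\alpha)=\sup_{y\in T_xM\setminus\{0\}}\alpha(y)/G(x,y)$, and for $u\in W^{1,2}_{\rm loc}(M)$ with weak differential $Du$ put $$\|u\|_G=\Big(\int_M G^{*}(x,Du(x))^2\,\mathrm d\mathsf m(x)+\int_M u(x)^2\,\mathrm d\mathsf m(x)\Big)^{1/2}\in[0,\infty]$$ (the same measure $\mathsf m$, that of $F$, is used for both). Let $W^{1,2}(M,F,\mathsf m)$ be the set of all $u\in W^{1,2}_{\rm loc}(M)$ with $\int_MF^{*}(x,Du(x))^2\,\mathrm d\mathsf m(x)<\infty$ (functions equal $\mathsf m$-a.e. are identified), and let $W^{1,2}_0(M,F,\mathsf m)$ be the closure of $C_0^\infty(M)$ with respect to $\|\cdot\|_F$, i.e. the set of all $u\in W^{1,2}(M,F,\mathsf m)$ such that for every $\varepsilon>0$ there is $\varphi\in C_0^\infty(M)$ with $\|\varphi-u\|_F<\varepsilon$. Then $W^{1,2}_0(M,F,\mathsf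 m)$ is a real vector space, $\|\cdot\|_{F_s}$ is a (finite) norm on it for which it is a reflexive Banach space, $\|\cdot\|_F$ is a (finite) asymmetric norm on it (nonnegative, zero only at $0$, subadditive, and $\|cu\|_F=c\|u\|_F$ for $c\ge0$), and the two are equivalent; more precisely, $$\Big(\frac{1+r_F^{2}}2\Big)^{-1/2}\|u\|_F\ \le\ \|u\|_{F_s}\ \le\ \Big(\frac{1+r_F^{-2}}2\Big)^{-1/2}\|u\|_F\qquad\text{for all }u\in W^{1,2}_0(M,F,\mathsf m).$$ -/

import Mathlib

open MeasureTheory Set Filter Topology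
open scoped Manifold ContDiff ENNReal

noncomputable section

namespace Finsler

variable {n : ℕ} {M : Type*} [TopologicalSpace M] [ChartedSpace (EuclideanSpace ℝ (Fin n)) M]

/-! ### Finsler metrics -/

/-- `F : TM → [0, ∞)` is a Finsler metric on the smooth `n`-manifold `M`. -/
structure IsFinslerMetric [IsManifold (𝓡 n) ∞ M] (F : TangentBundle (𝓡 n) M → ℝ) : Prop where
  nonneg : ∀ v, 0 ≤ F v
  continuous : Continuous F
  /-- `F` is smooth off the zero section. -/
  smooth : ContMDiffOn (𝓡 n).tangent 𝓘(ℝ, ℝ) ∞ F {v | v.2 ≠ 0}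
  /-- `F` is positively homogeneous. -/
  homogeneous : ∀ (x : M) (y : TangentSpace (𝓡 n) x) (t : ℝ), 0 ≤ t →
    F ⟨x, t • y⟩ = t * F ⟨x, y⟩
  /-- The fundamental tensor `g_(x,y)(w, w) = d²/dt² (F²(x, y + t w) / 2)` at `t = 0`, that is
  `g_ij(x,y) w^i w^j`, is positive definite at every `y ≠ 0`. -/
  posDef : ∀ (x : M) (y w : TangentSpace (𝓡 n) x), y ≠ 0 → w ≠ 0 →
    0 < iteratedDeriv 2 (fun t : ℝ => F ⟨x, y + t • w⟩ ^ 2 / 2) 0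

/-- The reversibility constant `r_F = sup_x sup_{y ≠ 0} F(x, y) / F(x, -y)`, in `[0, ∞]`. -/
def reversibility (F : TangentBundle (𝓡 n) M → ℝ) : ℝ≥0∞ :=
  ⨆ (x : M) (y : TangentSpace (𝓡 n) x) (_ : y ≠ 0), ENNReal.ofReal (F ⟨x, y⟩ / F ⟨x, -y⟩)

/-- The symmetrized metric `F_s(x, y) = ((F²(x, y) + F²(x, -y)) / 2)^(1/2)`. -/
def symmetrized (F : TangentBundle (𝓡 n) M → ℝ) : TangentBundle (𝓡 n) M → ℝ :=
  fun v => Real.sqrt ((F v ^ 2 + F ⟨v.1, -v.2⟩ ^ 2) / 2)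

/-- The polar transform (co-metric) `F*(x, α) = sup_{y ≠ 0} α(y) / F(x, y)`. -/
def polar (F : TangentBundle (𝓡 n) M → ℝ) (x : M) (α : TangentSpace (𝓡 n) x →L[ℝ] ℝ) : ℝ :=
  ⨆ y : {y : TangentSpace (𝓡 n) x // y ≠ 0}, α y / F ⟨x, y⟩

/-! ### Charts -/

/-- The tangent vector `y^i ∂/∂x^i` at the point with coordinates `p` in the chart `e`. -/
def chartVector (e : OpenPartialHomeomorph M (EuclideanSpace ℝ (Fin n)))
    (p y : EuclideanSpace ℝ (Fin n)) : TangentSpace (𝓡 n) (e.symm p) :=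
  mfderiv 𝓘(ℝ, EuclideanSpace ℝ (Fin n)) (𝓡 n) e.symm p y

/-- `F` written in the chart `e`: `(p, y) ↦ F(p, y^i ∂/∂x^i)`. -/
def chartMetric (F : TangentBundle (𝓡 n) M → ℝ)
    (e : OpenPartialHomeomorph M (EuclideanSpace ℝ (Fin n)))
    (p y : EuclideanSpace ℝ (Fin n)) : ℝ :=
  F ⟨e.symm p, chartVector e p y⟩

/-! ### Geodesics and completeness -/

/-- `σ` restricted to the interval `I` is a geodesic of `F`, parametrized with (nonzero) constant
speed: it is smooth on `I` and, inside `I`, it satisfies in every chart the geodesic equation, which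
is the Euler-Lagrange equation `d/dt (∂L/∂y (σ, σ')) = ∂L/∂x (σ, σ')` of `L = F² / 2`. -/
def IsGeodesicOn [IsManifold (𝓡 n) ∞ M] (F : TangentBundle (𝓡 n) M → ℝ) (σ : ℝ → M) (I : Set ℝ) :
    Prop :=
  ContMDiffOn 𝓘(ℝ, ℝ) (𝓡 n) ∞ σ I ∧
  ∀ t ∈ interior I, ∀ e ∈ atlas (EuclideanSpace ℝ (Fin n)) M, σ t ∈ e.source →
    deriv (e ∘ σ) t ≠ 0 ∧
    ∀ w : EuclideanSpace ℝ (Fin n),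
      HasDerivAt
        (fun s => fderiv ℝ (fun y => chartMetric F e (e (σ s)) y ^ 2 / 2) (deriv (e ∘ σ) s) w)
        (fderiv ℝ (fun p => chartMetric F e p (deriv (e ∘ σ) t) ^ 2 / 2) (e (σ t)) w) t

/-- Every geodesic `σ : [0, a] → M` extends to a geodesic on `[0, ∞)`. -/
def IsForwardComplete [IsManifold (𝓡 n) ∞ M] (F : TangentBundle (𝓡 n) M → ℝ) : Prop :=
  ∀ (a : ℝ) (σ : ℝ → M), 0 < a → IsGeodesicOn F σ (Icc 0 a) →
    ∃ τ : ℝ → M, IsGeodesicOn F τ (Ici 0) ∧ EqOn τ σ (Icc 0 a)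

/-- Every geodesic `σ : [0, a] → M` extends to a geodesic on `(-∞, a]`. -/
def IsBackwardComplete [IsManifold (𝓡 n) ∞ M] (F : TangentBundle (𝓡 n) M → ℝ) : Prop :=
  ∀ (a : ℝ) (σ : ℝ → M), 0 < a → IsGeodesicOn F σ (Icc 0 a) →
    ∃ τ : ℝ → M, IsGeodesicOn F τ (Iic a) ∧ EqOn τ σ (Icc 0 a)

/-! ### The Hausdorff volume -/

/-- The density `σ_F = ω_n / Vol {y : F(x, y^i ∂/∂x^i) < 1}` in the chart `e`. -/
def volumeDensity (F : TangentBundle (𝓡 n) M → ℝ)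
    (e : OpenPartialHomeomorph M (EuclideanSpace ℝ (Fin n)))
    (p : EuclideanSpace ℝ (Fin n)) : ℝ≥0∞ :=
  volume (Metric.ball (0 : EuclideanSpace ℝ (Fin n)) 1) /
    volume {y : EuclideanSpace ℝ (Fin n) | chartMetric F e p y < 1}

/-- The measure `σ_F(x) dx¹ … dxⁿ` on the domain of the chart `e`, extended by zero to `M`. -/
def chartVolume [MeasurableSpace M] (F : TangentBundle (𝓡 n) M → ℝ)
    (e : OpenPartialHomeomorph M (EuclideanSpace ℝ (Fin n))) : Measure M :=
  Measure.map e.symm ((volume.restrict e.target).withDensity (volumeDensity F e))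

/-- The Hausdorff volume `m = V_F` of `(M, F)`. The measures of the charts agree on overlaps, and
`m` is the measure glued from them, that is, the least measure that dominates all of them. -/
def hausdorffVolume [MeasurableSpace M] (F : TangentBundle (𝓡 n) M → ℝ) : Measure M :=
  ⨆ e ∈ atlas (EuclideanSpace ℝ (Fin n)) M, chartVolume F e

/-! ### Weak differentials and Sobolev spaces -/

/-- `u` belongs to `W^{1,2}_loc(M)` and the covector field `θ` is its weak differential: in each
chart, `u` and the components of `θ` are in `L²_loc`, and `∂u/∂v = θ(v)` weakly for every constant
direction `v`. -/
structure HasWeakDifferential [IsManifold (𝓡 n) ∞ M] (u : M → ℝ)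
    (θ : (x : M) → TangentSpace (𝓡 n) x →L[ℝ] ℝ) : Prop where
  memLp : ∀ e ∈ atlas (EuclideanSpace ℝ (Fin n)) M, ∀ K ⊆ e.target, IsCompact K →
    MemLp (fun p => u (e.symm p)) 2 (volume.restrict K)
  memLp_differential : ∀ e ∈ atlas (EuclideanSpace ℝ (Fin n)) M, ∀ K ⊆ e.target, IsCompact K →
    ∀ v : EuclideanSpace ℝ (Fin n),
      MemLp (fun p => θ (e.symm p) (chartVector e p v)) 2 (volume.restrict K)
  integral_eq : ∀ e ∈ atlas (EuclideanSpace ℝ (Fin n)) M,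
    ∀ φ : EuclideanSpace ℝ (Fin n) → ℝ, ContDiff ℝ ∞ φ → HasCompactSupport φ →
      tsupport φ ⊆ e.target → ∀ v : EuclideanSpace ℝ (Fin n),
        ∫ p, u (e.symm p) * fderiv ℝ φ p v = - ∫ p, θ (e.symm p) (chartVector e p v) * φ p

/-- `u ∈ W^{1,2}_loc(M)`. -/
def MemW12loc [IsManifold (𝓡 n) ∞ M] (u : M → ℝ) : Prop :=
  ∃ θ : (x : M) → TangentSpace (𝓡 n) x →L[ℝ] ℝ, HasWeakDifferential u θ

open Classical in
/-- The weak differential `Du` of `u ∈ W^{1,2}_loc(M)`; it is unique up to null sets. -/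
def weakDifferential [IsManifold (𝓡 n) ∞ M] (u : M → ℝ) :
    (x : M) → TangentSpace (𝓡 n) x →L[ℝ] ℝ :=
  if h : MemW12loc (n := n) u then h.choose else 0

/-- The energy `∫_M G*(x, Du(x))² dm(x)`. -/
def energy [IsManifold (𝓡 n) ∞ M] [MeasurableSpace M] (G : TangentBundle (𝓡 n) M → ℝ)
    (m : Measure M) (u : M → ℝ) : ℝ≥0∞ :=
  ∫⁻ x, ENNReal.ofReal (polar G x (weakDifferential u x) ^ 2) ∂m

/-- The Sobolev norm `‖u‖_G = (∫_M G*(x, Du(x))² dm(x) + ∫_M u(x)² dm(x))^(1/2)`, in `[0, ∞]`. -/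
def sobolevENorm [IsManifold (𝓡 n) ∞ M] [MeasurableSpace M] (G : TangentBundle (𝓡 n) M → ℝ)
    (m : Measure M) (u : M → ℝ) : ℝ≥0∞ :=
  (energy G m u + ∫⁻ x, ENNReal.ofReal (u x ^ 2) ∂m) ^ (1 / 2 : ℝ)

/-- The Sobolev norm `‖u‖_G` as a real number. -/
def sobolevNorm [IsManifold (𝓡 n) ∞ M] [MeasurableSpace M] (G : TangentBundle (𝓡 n) M → ℝ)
    (m : Measure M) (u : M → ℝ) : ℝ :=
  (sobolevENorm G m u).toReal

/-- `W^{1,2}(M, F, m)`: the classes (modulo equality `m`-a.e.) of functions in `W^{1,2}_loc(M)` with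
finite energy. -/
def W12 [IsManifold (𝓡 n) ∞ M] [MeasurableSpace M] (F : TangentBundle (𝓡 n) M → ℝ)
    (m : Measure M) : Set (M →ₘ[m] ℝ) :=
  {u | MemW12loc (n := n) u ∧ energy F m u < ⊤}

/-- `W_0^{1,2}(M, F, m)`: the closure in `W^{1,2}(M, F, m)` of the smooth functions with compact
support, with respect to the asymmetric norm `‖·‖_F`. -/
def W12Zero [IsManifold (𝓡 n) ∞ M] [MeasurableSpace M] (F : TangentBundle (𝓡 n) M → ℝ)
    (m : Measure M) : Set (M →ₘ[m] ℝ) :=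
  {u | u ∈ W12 F m ∧ ∀ ε : ℝ≥0∞, 0 < ε → ∃ φ : M → ℝ, ContMDiff (𝓡 n) 𝓘(ℝ, ℝ) ∞ φ ∧
    HasCompactSupport φ ∧ sobolevENorm F m (fun x => φ x - u x) < ε}

/-! ### Norms on vector spaces -/

/-- `N` is an asymmetric norm on the real vector space `X`. -/
structure IsAsymmetricNorm {X : Type*} [AddCommGroup X] [Module ℝ X] (N : X → ℝ) : Prop where
  nonneg : ∀ x, 0 ≤ N x
  eq_zero_iff : ∀ x, N x = 0 ↔ x = 0
  smul : ∀ (c : ℝ) (x : X), 0 ≤ c → N (c • x) = c * N x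
  add_le : ∀ x y, N (x + y) ≤ N x + N y

/-- `N` is a norm on the real vector space `X`, and `X` with this norm is a reflexive Banach
space: it is complete, and the canonical map into the bidual is onto. -/
def IsReflexiveBanachNorm {X : Type*} [AddCommGroup X] [Module ℝ X] (N : X → ℝ) : Prop :=
  letI : Norm X := ⟨N⟩
  ∃ core : NormedSpace.Core ℝ X,
    letI : NormedAddCommGroup X := NormedAddCommGroup.ofCore core
    letI : NormedSpace ℝ X := NormedSpace.ofCore core
    CompleteSpace X ∧ Function.Surjective (NormedSpace.inclusionInDoubleDual ℝ X)

end Finsler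

end

noncomputable section

namespace Finsler

/-! ### Reflexivity through an embedding into a Hilbert space -/

/-! Everything takes place at the level of gauges: continuous, positively homogeneous functions on
the tangent bundle that are positive off the zero section. Both `F` and its symmetrization are
gauges. Positivity of `F` comes from the fundamental tensor evaluated at w = y.

The two-sided estimate is pointwise. The bound F(-y) ≤ r F(y) gives F_s ≤ ((1 + r²)/2)^(1/2) F, and
applied at -y it gives F ≤ ((1 + r⁻²)/2)^(-1/2) F_s. The polar transform reverses inequalities
between gauges. Both constants are at least 1 because r ≥ 1, so the zeroth-order term u² obeys the
same bounds, and integration yields the comparison of norms. Finite reversibility is also what makes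
the closure of the test functions stable under multiplication by -1, hence a vector space.

Reflexivity is the deeper point, since the norm of F_s need not come from an inner product. It is
equivalent to one that does. In each tangent space an almost optimal Auerbach basis Y_1, ..., Y_n
for F_s is selected measurably (`exists_measurable_frame`, `exists_adapted_frame`): the vectors have
length one, and the coefficients of y are at most 2 F_s(y). Hence u ↦ (u, Du(Y_1), ..., Du(Y_n)) is
a linear map into the Hilbert space L²(M; ℝ^(1+n)), bounded above and below with constants depending
only on n (`norm_jet_le`, `jetNorm_le_norm_jet`). If its range is closed, the space is complete and
isomorphic to a Hilbert space, hence reflexive.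

Closedness of the range says that an L² limit of pairs (u_j, Du_j) is again a pair (u, Du), with u
still approximable by test functions. The first half passes to the limit in the weak formulation,
chart by chart (`HasWeakDifferential.of_tendsto`). This needs the Hausdorff volume to have a density
in each chart that is bounded above and away from zero on compact sets, which rests on the chart
measures agreeing on overlaps (`hausdorffVolume_restrict_source`). The second half is the triangle
inequality. -/

theorem surjective_inclusionInDoubleDual_of_equiv {X H : Type*} [NormedAddCommGroup X]
    [NormedSpace ℝ X] [NormedAddCommGroup H] [InnerProductSpace ℝ H] [CompleteSpace H]
    (T : X ≃L[ℝ] H) : Function.Surjective (NormedSpace.inclusionInDoubleDual ℝ X) := by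
  intro ξ
  let pull : (H →L[ℝ] ℝ) →L[ℝ] (X →L[ℝ] ℝ) :=
    (ContinuousLinearMap.compL ℝ X H ℝ).flip (T : X →L[ℝ] H)
  -- The functional w ↦ ξ(⟨w, T ·⟩) on H; its Riesz representative, carried back by T, is the vector
  -- that represents ξ.
  let ζ : H →L[ℝ] ℝ := (ξ.comp pull).comp (innerSL ℝ)
  refine ⟨T.symm ((InnerProductSpace.toDual ℝ H).symm ζ), ?_⟩
  ext f
  rw [NormedSpace.dual_def]
  have hf : f = pull (f.comp (T.symm : H →L[ℝ] X)) := by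
    ext x; simp [pull]
  obtain ⟨w, hw⟩ := (InnerProductSpace.toDual ℝ H).surjective (f.comp (T.symm : H →L[ℝ] X))
  have h1 : ζ w = ξ f := by
    rw [hf, ← hw]; rfl
  rw [← h1]
  have h2 : f (T.symm ((InnerProductSpace.toDual ℝ H).symm ζ))
      = (InnerProductSpace.toDual ℝ H w) ((InnerProductSpace.toDual ℝ H).symm ζ) := by
    rw [hw]; rfl
  rw [h2, InnerProductSpace.toDual_apply_apply, real_inner_comm,
    InnerProductSpace.toDual_symm_apply]

/-- A vector space with a norm equivalent to the one induced from a Hilbert space by an embedding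
with closed range is a reflexive Banach space. -/
theorem isReflexiveBanachNorm_of_embedding {X H : Type*} [AddCommGroup X] [Module ℝ X]
    [NormedAddCommGroup H] [InnerProductSpace ℝ H] [CompleteSpace H] (N : X → ℝ)
    (nonneg : ∀ x, 0 ≤ N x) (smul : ∀ (c : ℝ) x, N (c • x) = |c| * N x)
    (add_le : ∀ x y, N (x + y) ≤ N x + N y) (eq_zero_iff : ∀ x, N x = 0 ↔ x = 0)
    (J : X →ₗ[ℝ] H) (C₁ C₂ : NNReal) (upper : ∀ x, ‖J x‖ ≤ C₁ * N x)
    (lower : ∀ x, N x ≤ C₂ * ‖J x‖) (closed : IsClosed (range J)) :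
    IsReflexiveBanachNorm N := by
  let : Norm X := ⟨N⟩
  have core : NormedSpace.Core ℝ X :=
    { norm_nonneg := nonneg
      norm_smul := fun c x => by rw [Real.norm_eq_abs]; exact smul c x
      norm_triangle := add_le
      norm_eq_zero_iff := eq_zero_iff }
  refine ⟨core, ?_⟩
  let : NormedAddCommGroup X := NormedAddCommGroup.ofCore core
  let : NormedSpace ℝ X := NormedSpace.ofCore core
  let Jc : X →L[ℝ] H := J.mkContinuous C₁ upper
  have anti : AntilipschitzWith C₂ Jc := Jc.antilipschitz_of_bound lower
  have hr : IsClosed (range Jc) := closed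
  have : CompleteSpace X :=
    (anti.isUniformInducing Jc.uniformContinuous).completeSpace hr.isComplete
  refine ⟨this, ?_⟩
  have : CompleteSpace Jc.range := by
    have : IsClosed (Jc.range : Set H) := hr
    exact this.completeSpace_coe
  exact surjective_inclusionInDoubleDual_of_equiv (Jc.equivRange anti.injective hr)

/-! ### Measurable frames adapted to a family of gauges -/

/-- The minimum over the compact unit sphere is positive, and homogeneity spreads it to all vectors.
An empty sphere (dimension zero) is treated apart. -/
theorem exists_pos_mul_norm_le {E : Type*} [NormedAddCommGroup E] [NormedSpace ℝ E]
    [FiniteDimensional ℝ E] {G : E → ℝ} (hcont : Continuous G)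
    (hhom : ∀ (y : E) (t : ℝ), 0 ≤ t → G (t • y) = t * G y) (hpos : ∀ y, y ≠ 0 → 0 < G y) :
    ∃ a : ℝ, 0 < a ∧ ∀ y, a * ‖y‖ ≤ G y := by
  have : ProperSpace E := FiniteDimensional.proper ℝ E
  obtain ⟨a, ha, h⟩ : ∃ a : ℝ, 0 < a ∧ ∀ y ∈ Metric.sphere (0 : E) 1, a ≤ G y := by
    rcases (Metric.sphere (0 : E) 1).eq_empty_or_nonempty with h | h
    · exact ⟨1, one_pos, by simp [h]⟩
    · obtain ⟨y, hy, hmin⟩ := (isCompact_sphere (0 : E) 1).exists_isMinOn h hcont.continuousOn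
      exact ⟨G y, hpos y (by rintro rfl; simp at hy), fun z hz => hmin hz⟩
  refine ⟨a, ha, fun y => ?_⟩
  rcases eq_or_ne y 0 with rfl | hy
  · have := hhom 0 0 le_rfl
    simp at this
    simp [this]
  · have hn : 0 < ‖y‖ := norm_pos_iff.2 hy
    have h1 := h (‖y‖⁻¹ • y) (by simp [norm_smul, hn.ne'])
    rw [hhom _ _ (by positivity)] at h1
    calc a * ‖y‖ ≤ (‖y‖⁻¹ * G y) * ‖y‖ := by gcongr
      _ = G y := by field_simp

/-- An approximate Auerbach basis chosen measurably. A tuple that maximizes |det w| / ∏ G(w_i) up to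
a factor 2 has, by Cramer's rule, normalized coordinates bounded by 2 G. Searching a countable dense
set of tuples and taking the first admissible index makes the choice measurable in x; the factor 2
is the price for a supremum that need not be attained there. -/
theorem exists_measurable_frame {X : Type*} [MeasurableSpace X] {n : ℕ}
    (G : X → EuclideanSpace ℝ (Fin n) → ℝ) (hmeas : ∀ y, Measurable fun x => G x y)
    (hcont : ∀ x, Continuous (G x)) (hhom : ∀ x y (t : ℝ), 0 ≤ t → G x (t • y) = t * G x y)
    (hpos : ∀ x y, y ≠ 0 → 0 < G x y) :
    ∃ z : Fin n → X → EuclideanSpace ℝ (Fin n), (∀ i, Measurable (z i)) ∧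
      (∀ x i, G x (z i x) = 1) ∧
      ∀ x y, ∃ c : Fin n → ℝ, y = ∑ i, c i • z i x ∧ ∀ i, |c i| ≤ 2 * G x y := by
  classical
  let E := EuclideanSpace ℝ (Fin n)
  let b : Module.Basis (Fin n) ℝ E := (EuclideanSpace.basisFun (Fin n) ℝ).toBasis
  let δ : (Fin n → E) → ℝ := fun w => |b.det w|
  let d : ℕ → Fin n → E := TopologicalSpace.denseSeq (Fin n → E)
  have hd : DenseRange d := TopologicalSpace.denseRange_denseSeq _
  have hG0 : ∀ x y, 0 ≤ G x y := fun x y => by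
    obtain ⟨a, ha, h⟩ := exists_pos_mul_norm_le (hcont x) (hhom x) (hpos x)
    exact (by positivity : 0 ≤ a * ‖y‖).trans (h y)
  have hdet : Continuous fun w : Fin n → E => b.det w := by
    simp only [Module.Basis.det_apply]
    refine Continuous.matrix_det (continuous_matrix fun i j => ?_)
    simp only [b, Module.Basis.toMatrix_apply, OrthonormalBasis.coe_toBasis_repr_apply]
    fun_prop
  have hδc : Continuous δ := by
    exact hdet.abs
  obtain ⟨A, hA0, hA⟩ : ∃ A : ℝ, 0 ≤ A ∧ ∀ w, δ w ≤ A * ∏ i, ‖w i‖ := by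
    obtain ⟨A, hA, h⟩ := b.det.toMultilinearMap.exists_bound_of_continuous hdet
    exact ⟨A, hA.le, h⟩
  have hδ0 : ∀ w : Fin n → E, ∀ i, w i = 0 → δ w = 0 := fun w i hw => by
    simp only [δ]; rw [b.det.map_coord_zero i hw, abs_zero]
  let V : ℕ → X → ℝ := fun k x => δ (d k) / ∏ i, G x (d k i)
  have hV0 : ∀ k x, 0 ≤ V k x := fun k x =>
    div_nonneg (abs_nonneg _) (Finset.prod_nonneg fun i _ => hG0 x _)
  -- A tuple with a zero entry has zero determinant, so the product form survives division by zero.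
  have hδV : ∀ k x, δ (d k) = V k x * ∏ i, G x (d k i) := fun k x => by
    by_cases h : ∃ i, d k i = 0
    · obtain ⟨i, hi⟩ := h
      simp only [V]
      rw [hδ0 _ i hi]; simp
    · push Not at h
      have : ∏ i, G x (d k i) ≠ 0 := Finset.prod_ne_zero_iff.2 fun i _ => (hpos x _ (h i)).ne'
      simp only [V]; field_simp
  have hVm : ∀ k, Measurable (V k) := fun k =>
    measurable_const.div (Finset.measurable_prod _ fun i _ => hmeas _)
  have hex : ∀ x, ∃ k, δ (d k) ≠ 0 ∧ ∀ j, V j x ≤ 2 * V k x := by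
    intro x
    obtain ⟨a, ha, h⟩ := exists_pos_mul_norm_le (hcont x) (hhom x) (hpos x)
    have hbdd : BddAbove (range fun k => V k x) := by
      refine ⟨A / a ^ n, ?_⟩
      -- The bound A / a ^ n combines |det w| ≤ A ∏ ‖w i‖ with a ‖y‖ ≤ G y in each of the n slots.
      rintro _ ⟨k, rfl⟩
      by_cases h0 : ∃ i, d k i = 0
      · obtain ⟨i, hi⟩ := h0
        simp only [V]; rw [hδ0 _ i hi]; simp; positivity
      · push Not at h0
        have hp : 0 < ∏ i, G x (d k i) := Finset.prod_pos fun i _ => hpos x _ (h0 i)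
        simp only [V]
        rw [div_le_div_iff₀ hp (by positivity)]
        calc δ (d k) * a ^ n ≤ (A * ∏ i, ‖d k i‖) * a ^ n := by gcongr; exact hA _
          _ = A * ∏ i, (a * ‖d k i‖) := by
            rw [Finset.prod_mul_distrib]; simp; ring
          _ ≤ A * ∏ i, G x (d k i) := by
            gcongr with i; exact h _
    obtain ⟨j, hj⟩ : ∃ j, δ (d j) ≠ 0 := by
      have ho : IsOpen {w | δ w ≠ 0} := isOpen_ne_fun hδc continuous_const
      obtain ⟨j, hj⟩ := hd.exists_mem_open ho ⟨b, by simp [δ, b.det_self]⟩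
      exact ⟨j, hj⟩
    have hVj : 0 < V j x := by
      refine lt_of_le_of_ne (hV0 j x) fun h0 => hj ?_
      rw [hδV j x, ← h0, zero_mul]
    have hS : 0 < ⨆ k, V k x := hVj.trans_le (le_ciSup hbdd j)
    obtain ⟨k, hk⟩ := exists_lt_of_lt_ciSup (half_lt_self hS)
    refine ⟨k, fun h0 => ?_, fun i => ?_⟩
    · have : V k x = 0 := by simp only [V]; rw [h0, zero_div]
      linarith
    · have := le_ciSup hbdd i
      linarith
  let κ : X → ℕ := fun x => Nat.find (hex x)
  have hκ : ∀ x, δ (d (κ x)) ≠ 0 ∧ ∀ j, V j x ≤ 2 * V (κ x) x := fun x => Nat.find_spec (hex x)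
  have hdne : ∀ x i, d (κ x) i ≠ 0 := fun x i h => (hκ x).1 (hδ0 _ i h)
  refine ⟨fun i x => (G x (d (κ x) i))⁻¹ • d (κ x) i, fun i => ?_, fun x i => ?_, fun x y => ?_⟩
  · refine Measurable.find (f := fun k x => (G x (d k i))⁻¹ • d k i)
      (p := fun k x => δ (d k) ≠ 0 ∧ ∀ j, V j x ≤ 2 * V k x)
      (fun k => ((hmeas _).inv).smul_const _) (fun k => ?_) hex
    have hle : MeasurableSet {x | ∀ j, V j x ≤ 2 * V k x} := by
      rw [show {x | ∀ j, V j x ≤ 2 * V k x} = ⋂ j, {x | V j x ≤ 2 * V k x} by ext; simp]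
      exact MeasurableSet.iInter fun j => measurableSet_le (hVm j) ((hVm k).const_mul 2)
    exact (MeasurableSet.const _).inter hle
  · have h := hpos x _ (hdne x i)
    rw [hhom _ _ _ (inv_nonneg.2 h.le), inv_mul_cancel₀ h.ne']
  · obtain ⟨hk, hmax⟩ := hκ x
    set w := d (κ x) with hw
    -- With the denominator cleared this is a closed condition on v, so density extends
    -- near-maximality from the sequence to all tuples, including degenerate ones.
    have hbound : ∀ v : Fin n → E, δ v ≤ 2 * V (κ x) x * ∏ i, G x (v i) := by
      intro v
      have hc : IsClosed {v : Fin n → E | δ v ≤ 2 * V (κ x) x * ∏ i, G x (v i)} :=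
        isClosed_le hδc (continuous_const.mul
          (continuous_finsetProd _ fun i _ => (hcont x).comp (continuous_apply i)))
      refine hd.induction_on v hc fun j => ?_
      rw [hδV j x]
      gcongr
      · exact Finset.prod_nonneg fun i _ => hG0 _ _
      · exact hmax j
    have hu : IsUnit (b.det w) := by
      rw [isUnit_iff_ne_zero]
      intro h; exact hk (by simp [δ, h])
    obtain ⟨hli, hsp⟩ := (b.is_basis_iff_det (v := w)).2 hu
    let B := Module.Basis.mk hli hsp.ge
    refine ⟨fun i => B.coord i y * G x (w i), ?_, fun i => ?_⟩
    · conv_lhs => rw [← B.sum_repr y]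
      refine Finset.sum_congr rfl fun i _ => ?_
      have h := hpos x _ (hdne x i)
      rw [smul_smul, mul_assoc, mul_inv_cancel₀ h.ne', mul_one]
      rw [Module.Basis.coord_apply, Module.Basis.mk_apply]
    · have h := hpos x _ (hdne x i)
      -- Cramer's rule. Testing near-maximality on w with its i-th vector replaced by y then bounds
      -- the i-th coordinate, all other factors cancelling.
      have hcr : b.det w * B.coord i y = b.det (Function.update w i y) := by
        have := congrArg (fun l => l y) (b.det_smul_mk_coord_eq_det_update hli hsp.ge i)
        exact this
      have h1 : δ w * |B.coord i y| ≤ 2 * V (κ x) x * ∏ j, G x (Function.update w i y j) := by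
        rw [← abs_mul, hcr]; exact hbound _
      have h2 : (∏ j, G x (Function.update w i y j)) * G x (w i)
          = G x y * ∏ j, G x (w j) := by
        rw [← Finset.mul_prod_erase _ _ (Finset.mem_univ i),
          ← Finset.mul_prod_erase Finset.univ (fun j => G x (w j)) (Finset.mem_univ i)]
        have : ∏ j ∈ Finset.univ.erase i, G x (Function.update w i y j)
            = ∏ j ∈ Finset.univ.erase i, G x (w j) :=
          Finset.prod_congr rfl fun j hj => by
            rw [Function.update_of_ne (Finset.ne_of_mem_erase hj)]
        rw [this]; simp; ring
      have hδpos : 0 < δ w := lt_of_le_of_ne (abs_nonneg _) (Ne.symm hk)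
      have h3 : δ w * (|B.coord i y| * G x (w i)) ≤ δ w * (2 * G x y) := by
        calc δ w * (|B.coord i y| * G x (w i)) = (δ w * |B.coord i y|) * G x (w i) := by ring
          _ ≤ (2 * V (κ x) x * ∏ j, G x (Function.update w i y j)) * G x (w i) := by gcongr
          _ = 2 * G x y * (V (κ x) x * ∏ j, G x (w j)) := by
            rw [mul_assoc, h2]; ring
          _ = δ w * (2 * G x y) := by rw [← hδV]; ring
      rw [abs_mul, abs_of_pos h]
      exact le_of_mul_le_mul_left h3 hδpos

variable {n : ℕ} {M : Type*} [TopologicalSpace M] [ChartedSpace (EuclideanSpace ℝ (Fin n)) M]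

/-! ### Gauges on the tangent bundle -/

/-- A continuous function on the tangent bundle that is positive off the zero section and
positively homogeneous. -/
structure IsGauge [IsManifold (𝓡 n) ∞ M] (G : TangentBundle (𝓡 n) M → ℝ) : Prop where
  continuous : Continuous G
  homogeneous : ∀ (x : M) (y : TangentSpace (𝓡 n) x) (t : ℝ), 0 ≤ t →
    G ⟨x, t • y⟩ = t * G ⟨x, y⟩
  pos : ∀ (x : M) (y : TangentSpace (𝓡 n) x), y ≠ 0 → 0 < G ⟨x, y⟩

section Gauge

variable [IsManifold (𝓡 n) ∞ M] {F G : TangentBundle (𝓡 n) M → ℝ}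

theorem IsFinslerMetric.isGauge (hF : IsFinslerMetric F) : IsGauge F where
  continuous := hF.continuous
  homogeneous := hF.homogeneous
  pos x y hy := by
    have h := hF.posDef x y y hy hy
    refine lt_of_le_of_ne (hF.nonneg _) fun h0 => ?_
    -- If F(x, y) = 0, homogeneity makes F vanish on (1 + t) y for t > -1, against positivity of the
    -- second derivative in the direction y.
    have heq : (fun t : ℝ => F ⟨x, y + t • y⟩ ^ 2 / 2) =ᶠ[𝓝 0] fun _ => 0 := by
      filter_upwards [Ioi_mem_nhds (show (-1 : ℝ) < 0 by norm_num)] with t ht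
      have ht' : (0 : ℝ) ≤ 1 + t := by
        have : (-1 : ℝ) < t := ht
        linarith
      have hyt : y + t • y = (1 + t) • y := by rw [add_smul, one_smul]
      rw [hyt, hF.homogeneous x y _ ht', ← h0]
      simp
    rw [heq.iteratedDeriv_eq] at h
    simp at h

theorem IsGauge.zero (hG : IsGauge G) (x : M) : G ⟨x, 0⟩ = 0 := by
  have := hG.homogeneous x 0 0 le_rfl
  simpa using this

theorem IsGauge.nonneg (hG : IsGauge G) (x : M) (y : TangentSpace (𝓡 n) x) : 0 ≤ G ⟨x, y⟩ := by
  rcases eq_or_ne y 0 with rfl | hy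
  · rw [hG.zero]
  · exact (hG.pos x y hy).le

/-- Continuity is tested in a local trivialization, where linearity on the fibres turns the map into
negation in the model space. -/
theorem continuous_neg_tangentBundle :
    Continuous fun v : TangentBundle (𝓡 n) M => (⟨v.1, -v.2⟩ : TangentBundle (𝓡 n) M) := by
  have : IsManifold (𝓡 n) 1 M := IsManifold.of_le (n := ∞) (by simp)
  refine continuous_iff_continuousAt.2 fun v => ?_
  rw [FiberBundle.continuousAt_totalSpace]
  refine ⟨(FiberBundle.continuous_proj _ _).continuousAt, ?_⟩
  set T := trivializationAt (EuclideanSpace ℝ (Fin n)) (TangentSpace (𝓡 n) : M → Type _) v.1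
  have hbase : v.1 ∈ T.baseSet := FiberBundle.mem_baseSet_trivializationAt' v.1
  have h1 : ContinuousAt (fun w : TangentBundle (𝓡 n) M => -(T w).2) v :=
    (continuousAt_snd.comp (T.continuousAt (T.mem_source.2 hbase))).neg
  refine h1.congr ?_
  filter_upwards [(FiberBundle.continuous_proj (EuclideanSpace ℝ (Fin n))
    (TangentSpace (𝓡 n) : M → Type _)).continuousAt.preimage_mem_nhds
    (T.open_baseSet.mem_nhds hbase)] with w hw
  exact ((T.linear ℝ hw).map_neg w.2).symm

theorem IsGauge.symmetrized (hG : IsGauge G) : IsGauge (symmetrized G) where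
  continuous := by
    refine Real.continuous_sqrt.comp ?_
    have := hG.continuous.comp continuous_neg_tangentBundle
    exact ((hG.continuous.pow 2).add (this.pow 2)).div_const 2
  homogeneous x y t ht := by
    simp only [Finsler.symmetrized]
    rw [← smul_neg, hG.homogeneous x y t ht, hG.homogeneous x (-y) t ht,
      ← Real.sqrt_sq ht, ← Real.sqrt_mul (sq_nonneg t), Real.sqrt_sq ht]
    congr 1; ring
  pos x y hy := by
    have := hG.pos x y hy
    exact Real.sqrt_pos.2 (by positivity)

omit [IsManifold (𝓡 n) ∞ M] in
theorem symmetrized_neg (x : M) (y : TangentSpace (𝓡 n) x) :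
    symmetrized G ⟨x, -y⟩ = symmetrized G ⟨x, y⟩ := by
  simp only [symmetrized, neg_neg, add_comm]

end Gauge

/-! ### Charts -/

section Chart

variable [IsManifold (𝓡 n) ∞ M] {G : TangentBundle (𝓡 n) M → ℝ}
  {e e' : OpenPartialHomeomorph M (EuclideanSpace ℝ (Fin n))}

theorem mdifferentiable_atlas (he : e ∈ atlas (EuclideanSpace ℝ (Fin n)) M) :
    e.MDifferentiable (𝓡 n) (𝓡 n) :=
  have : IsManifold (𝓡 n) 1 M := IsManifold.of_le (n := ∞) (by simp)
  mdifferentiable_of_mem_atlas he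

omit [IsManifold (𝓡 n) ∞ M] in
theorem chartVector_smul (p v : EuclideanSpace ℝ (Fin n)) (c : ℝ) :
    chartVector e p (c • v) = c • chartVector e p v :=
  map_smul (mfderiv 𝓘(ℝ, EuclideanSpace ℝ (Fin n)) (𝓡 n) e.symm p) c v

theorem chartVector_bijective (he : e ∈ atlas (EuclideanSpace ℝ (Fin n)) M)
    {p : EuclideanSpace ℝ (Fin n)} (hp : p ∈ e.target) : Function.Bijective (chartVector e p) :=
  (mdifferentiable_atlas he).symm.mfderiv_bijective hp

/-- This map is the tangent map of the inverse chart, read through the trivialization of the tangent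
bundle of the model space. -/
theorem continuousOn_chartVector (he : e ∈ atlas (EuclideanSpace ℝ (Fin n)) M) :
    ContinuousOn (fun q : EuclideanSpace ℝ (Fin n) × EuclideanSpace ℝ (Fin n) =>
      (⟨e.symm q.1, chartVector e q.1 q.2⟩ : TangentBundle (𝓡 n) M)) (e.target ×ˢ univ) := by
  have : IsManifold (𝓡 n) 1 M := IsManifold.of_le (n := ∞) (by simp)
  have h1 : ContMDiffOn (𝓡 n) (𝓡 n) 1 e.symm e.target :=
    contMDiffOn_symm_of_mem_maximalAtlas (IsManifold.subset_maximalAtlas he)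
  have h2 := h1.continuousOn_tangentMapWithin le_rfl e.open_target.uniqueMDiffOn
  have h3 := h2.comp (s := e.target ×ˢ univ)
    (tangentBundleModelSpaceHomeomorph (𝓡 n)).symm.continuous.continuousOn
    (fun q hq => hq.1)
  refine h3.congr fun q hq => ?_
  change _ = tangentMapWithin (𝓡 n) (𝓡 n) e.symm e.target ⟨q.1, q.2⟩
  simp only [tangentMapWithin]
  rw [mfderivWithin_of_isOpen e.open_target hq.1]
  rfl

theorem continuousOn_chartMetric (hG : IsGauge G)
    (he : e ∈ atlas (EuclideanSpace ℝ (Fin n)) M) :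
    ContinuousOn (fun q : EuclideanSpace ℝ (Fin n) × EuclideanSpace ℝ (Fin n) =>
      chartMetric G e q.1 q.2) (e.target ×ˢ univ) :=
  hG.continuous.comp_continuousOn (continuousOn_chartVector he)

theorem chartMetric_smul (hG : IsGauge G) (p y : EuclideanSpace ℝ (Fin n)) {t : ℝ} (ht : 0 ≤ t) :
    chartMetric G e p (t • y) = t * chartMetric G e p y := by
  simp only [chartMetric]
  rw [chartVector_smul, hG.homogeneous _ _ _ ht]

theorem chartMetric_pos (hG : IsGauge G) (he : e ∈ atlas (EuclideanSpace ℝ (Fin n)) M)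
    {p y : EuclideanSpace ℝ (Fin n)} (hp : p ∈ e.target) (hy : y ≠ 0) :
    0 < chartMetric G e p y := by
  refine hG.pos _ _ fun h => hy ((chartVector_bijective he hp).1 ?_)
  rw [h]
  exact (map_zero (mfderiv 𝓘(ℝ, EuclideanSpace ℝ (Fin n)) (𝓡 n) e.symm p)).symm

/-- On compact subsets of a chart a gauge is comparable to the Euclidean norm. -/
theorem exists_chartMetric_bounds (hG : IsGauge G)
    (he : e ∈ atlas (EuclideanSpace ℝ (Fin n)) M) {K : Set (EuclideanSpace ℝ (Fin n))}
    (hK : IsCompact K) (hKe : K ⊆ e.target) :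
    ∃ a b : ℝ, 0 < a ∧ 0 < b ∧ ∀ p ∈ K, ∀ y, a * ‖y‖ ≤ chartMetric G e p y ∧
      chartMetric G e p y ≤ b * ‖y‖ := by
  have hc : IsCompact (K ×ˢ Metric.sphere (0 : EuclideanSpace ℝ (Fin n)) 1) :=
    hK.prod (isCompact_sphere _ _)
  have hcont := (continuousOn_chartMetric hG he).mono
    (show K ×ˢ Metric.sphere (0 : EuclideanSpace ℝ (Fin n)) 1 ⊆ e.target ×ˢ univ from
      prod_mono hKe (subset_univ _))
  obtain ⟨a, b, ha, hb, hab⟩ : ∃ a b : ℝ, 0 < a ∧ 0 < b ∧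
      ∀ q ∈ K ×ˢ Metric.sphere (0 : EuclideanSpace ℝ (Fin n)) 1,
        a ≤ chartMetric G e q.1 q.2 ∧ chartMetric G e q.1 q.2 ≤ b := by
    rcases (K ×ˢ Metric.sphere (0 : EuclideanSpace ℝ (Fin n)) 1).eq_empty_or_nonempty with h | h
    · exact ⟨1, 1, one_pos, one_pos, by simp [h]⟩
    · obtain ⟨q, hq, hmin⟩ := hc.exists_isMinOn h hcont
      obtain ⟨q', hq', hmax⟩ := hc.exists_isMaxOn h hcont
      have hpos : ∀ q ∈ K ×ˢ Metric.sphere (0 : EuclideanSpace ℝ (Fin n)) 1,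
          0 < chartMetric G e q.1 q.2 := fun q hq =>
        chartMetric_pos hG he (hKe hq.1) (by rintro h; have := hq.2; simp [h] at this)
      exact ⟨_, _, hpos q hq, hpos q' hq', fun z hz => ⟨hmin hz, hmax hz⟩⟩
  refine ⟨a, b, ha, hb, fun p hp y => ?_⟩
  rcases eq_or_ne y 0 with rfl | hy
  · have := chartMetric_smul (e := e) hG p 0 le_rfl
    simp at this
    simp [this]
  · have hn : 0 < ‖y‖ := norm_pos_iff.2 hy
    have h1 := hab (p, ‖y‖⁻¹ • y) ⟨hp, by simp [norm_smul, hn.ne']⟩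
    simp only at h1
    rw [chartMetric_smul hG _ _ (by positivity), inv_mul_eq_div, le_div_iff₀ hn,
      div_le_iff₀ hn] at h1
    exact h1

/-- The change of coordinates for tangent vectors. -/
theorem chartVector_transition (he : e ∈ atlas (EuclideanSpace ℝ (Fin n)) M)
    (he' : e' ∈ atlas (EuclideanSpace ℝ (Fin n)) M) {p : EuclideanSpace ℝ (Fin n)}
    (hp : p ∈ e.target) (hp' : e.symm p ∈ e'.source) (v : EuclideanSpace ℝ (Fin n)) :
    DifferentiableAt ℝ (e' ∘ e.symm) p ∧
    (⟨e.symm p, chartVector e p v⟩ : TangentBundle (𝓡 n) M) =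
      ⟨e'.symm (e' (e.symm p)),
        chartVector e' (e' (e.symm p)) (fderiv ℝ (e' ∘ e.symm) p v)⟩ := by
  have hd := mdifferentiable_atlas he
  have hd' := mdifferentiable_atlas he'
  have hτ : MDifferentiableAt (𝓡 n) (𝓡 n) (e' ∘ e.symm) p :=
    (hd'.mdifferentiableAt hp').comp p (hd.mdifferentiableAt_symm hp)
  refine ⟨hτ.differentiableAt, ?_⟩
  have heq : e.symm =ᶠ[𝓝 p] e'.symm ∘ (e' ∘ e.symm) := by
    have : e.symm ⁻¹' e'.source ∈ 𝓝 p :=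
      (e.continuousAt_symm hp).preimage_mem_nhds (e'.open_source.mem_nhds hp')
    filter_upwards [this] with q hq
    exact (e'.left_inv hq).symm
  have h1 : tangentMap (𝓡 n) (𝓡 n) e.symm ⟨p, v⟩
      = tangentMap (𝓡 n) (𝓡 n) (e'.symm ∘ (e' ∘ e.symm)) ⟨p, v⟩ := by
    simp only [tangentMap]
    rw [heq.mfderiv_eq]
    congr 1
    exact heq.eq_of_nhds
  have h2 := tangentMap_comp_at (I := 𝓡 n) (I' := 𝓡 n) (I'' := 𝓡 n) (f := e' ∘ e.symm)
    (g := e'.symm) ⟨p, v⟩ (hd'.mdifferentiableAt_symm (e'.map_source hp')) hτ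
  refine h1.trans (h2.trans ?_)
  simp only [tangentMap, mfderiv_eq_fderiv]
  rfl

end Chart

/-! ### The Hausdorff volume in charts -/

/-- Local L² conditions and density bounds are available on compact subsets of a chart only; this
exhaustion transfers almost everywhere statements to the whole chart. -/
theorem exists_isCompact_iUnion_eq {E : Type*} [TopologicalSpace E] [LocallyCompactSpace E]
    [SecondCountableTopology E] {U : Set E} (hU : IsOpen U) :
    ∃ K : ℕ → Set E, (∀ i, IsCompact (K i)) ∧ ⋃ i, K i = U := by
  have : LocallyCompactSpace U := hU.locallyCompactSpace
  have : SigmaCompactSpace U := inferInstance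
  exact isSigmaCompact_iff_sigmaCompactSpace.2 this

section Measure

variable [IsManifold (𝓡 n) ∞ M] [MeasurableSpace M] [BorelSpace M]
  {G : TangentBundle (𝓡 n) M → ℝ} {e e' : OpenPartialHomeomorph M (EuclideanSpace ℝ (Fin n))}

omit [MeasurableSpace M] [BorelSpace M] in
-- The unit ball in one chart is the preimage, under the Jacobian of the transition map, of the unit
-- ball in the other, so its Lebesgue volume is divided by |det|.
theorem volumeDensity_transition (he : e ∈ atlas (EuclideanSpace ℝ (Fin n)) M)
    (he' : e' ∈ atlas (EuclideanSpace ℝ (Fin n)) M) {p : EuclideanSpace ℝ (Fin n)}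
    (hp : p ∈ e.target) (hp' : e.symm p ∈ e'.source) :
    volumeDensity G e p = ENNReal.ofReal |(fderiv ℝ (e' ∘ e.symm) p).det| *
      volumeDensity G e' (e' (e.symm p)) := by
  set L := fderiv ℝ (e' ∘ e.symm) p with hL
  have hmet : ∀ v, chartMetric G e p v = chartMetric G e' (e' (e.symm p)) (L v) := fun v =>
    congrArg G (chartVector_transition he he' hp hp' v).2
  have hinj : Function.Injective L := by
    intro v w hvw
    have h1 := (chartVector_transition he he' hp hp' v).2
    have h2 := (chartVector_transition he he' hp hp' w).2
    rw [← hL, hvw] at h1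
    have h3 := h1.trans h2.symm
    exact (chartVector_bijective he hp).1 (eq_of_heq (Bundle.TotalSpace.mk.inj h3).2)
  have hdet : L.det ≠ 0 := by
    exact (LinearEquiv.isUnit_det' (LinearEquiv.ofInjectiveEndo
      (L : EuclideanSpace ℝ (Fin n) →ₗ[ℝ] EuclideanSpace ℝ (Fin n)) hinj)).ne_zero
  have hset : {y | chartMetric G e p y < 1}
      = L ⁻¹' {y | chartMetric G e' (e' (e.symm p)) y < 1} := by
    ext y; simp [hmet]
  have h0 : ENNReal.ofReal |L.det| ≠ 0 := by simpa using hdet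
  simp only [volumeDensity]
  rw [hset, Measure.addHaar_preimage_continuousLinearMap _ hdet, abs_inv,
    ENNReal.ofReal_inv_of_pos (abs_pos.2 hdet), ENNReal.div_eq_inv_mul,
    ENNReal.mul_inv (Or.inl (by simp)) (Or.inl (by simpa using hdet)), inv_inv,
    ENNReal.div_eq_inv_mul, mul_assoc]

omit [ChartedSpace (EuclideanSpace ℝ (Fin n)) M] [IsManifold (𝓡 n) ∞ M] in
theorem aemeasurable_symm (e : OpenPartialHomeomorph M (EuclideanSpace ℝ (Fin n))) :
    AEMeasurable e.symm (volume.restrict e.target) :=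
  e.continuousOn_symm.aemeasurable e.open_target.measurableSet

omit [ChartedSpace (EuclideanSpace ℝ (Fin n)) M] [IsManifold (𝓡 n) ∞ M] in
theorem measurableSet_target_inter_preimage
    (e : OpenPartialHomeomorph M (EuclideanSpace ℝ (Fin n))) {A : Set M} (hA : MeasurableSet A) :
    MeasurableSet (e.target ∩ e.symm ⁻¹' A) := by
  have : Measurable (e.target.domRestrict e.symm) :=
    (continuousOn_iff_continuous_domRestrict.1 e.continuousOn_symm).measurable
  have h := MeasurableSet.subtype_image e.open_target.measurableSet (this hA)
  convert h using 1
  ext x; simp [and_comm]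

omit [ChartedSpace (EuclideanSpace ℝ (Fin n)) M] [IsManifold (𝓡 n) ∞ M] in
theorem measurableSet_source_inter_preimage
    (e : OpenPartialHomeomorph M (EuclideanSpace ℝ (Fin n)))
    {A : Set (EuclideanSpace ℝ (Fin n))} (hA : MeasurableSet A) :
    MeasurableSet (e.source ∩ e ⁻¹' A) := by
  have : Measurable (e.source.domRestrict e) :=
    (continuousOn_iff_continuous_domRestrict.1 e.continuousOn).measurable
  have h := MeasurableSet.subtype_image e.open_source.measurableSet (this hA)
  convert h using 1
  ext x; simp [and_comm]

omit [IsManifold (𝓡 n) ∞ M] in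
theorem chartVolume_apply (e : OpenPartialHomeomorph M (EuclideanSpace ℝ (Fin n))) {A : Set M}
    (hA : MeasurableSet A) :
    chartVolume G e A = ∫⁻ p in e.target ∩ e.symm ⁻¹' A, volumeDensity G e p := by
  rw [chartVolume, Measure.map_apply_of_aemeasurable
    ((aemeasurable_symm e).mono_ac (withDensity_absolutelyContinuous _ _)) hA,
    withDensity_apply', Measure.restrict_restrict' e.open_target.measurableSet, inter_comm]

/-- Change of variables along the transition map: its Jacobian factor is exactly the one by which
the densities differ. -/
theorem chartVolume_restrict_comm (he : e ∈ atlas (EuclideanSpace ℝ (Fin n)) M)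
    (he' : e' ∈ atlas (EuclideanSpace ℝ (Fin n)) M) {A : Set M} (hA : MeasurableSet A)
    (hAe : A ⊆ e.source) (hAe' : A ⊆ e'.source) : chartVolume G e A = chartVolume G e' A := by
  rw [chartVolume_apply e hA, chartVolume_apply e' hA]
  set S := e.target ∩ e.symm ⁻¹' A with hS
  have himg : (e' ∘ e.symm) '' S = e'.target ∩ e'.symm ⁻¹' A := by
    ext q
    constructor
    · rintro ⟨p, ⟨hp, hpA⟩, rfl⟩
      have hpA' : e.symm p ∈ A := hpA
      refine ⟨e'.map_source (hAe' hpA'), ?_⟩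
      simp only [Function.comp_apply, mem_preimage]
      rwa [e'.left_inv (hAe' hpA')]
    · rintro ⟨hq, hqA⟩
      have hqA' : e'.symm q ∈ A := hqA
      refine ⟨e (e'.symm q), ⟨e.map_source (hAe hqA'), ?_⟩, ?_⟩
      · simp only [mem_preimage]
        rwa [e.left_inv (hAe hqA')]
      · simp only [Function.comp_apply]
        rw [e.left_inv (hAe hqA'), e'.right_inv hq]
  rw [← himg, lintegral_image_eq_lintegral_abs_det_fderiv_mul volume
    (measurableSet_target_inter_preimage e hA)
    (f' := fun p => fderiv ℝ (e' ∘ e.symm) p)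
    (fun p hp => (chartVector_transition he he' hp.1 (hAe' hp.2) 0).1.hasFDerivAt.hasFDerivWithinAt)
    ?_]
  · refine setLIntegral_congr_fun (measurableSet_target_inter_preimage e hA) fun p hp => ?_
    exact volumeDensity_transition he he' hp.1 (hAe' hp.2)
  · intro p hp q hq hpq
    have h1 := congrArg e'.symm hpq
    simp only [Function.comp_apply] at h1
    rw [e'.left_inv (hAe' hp.2), e'.left_inv (hAe' hq.2)] at h1
    have h2 := congrArg e h1
    rwa [e.right_inv hp.1, e.right_inv hq.1] at h2

omit [IsManifold (𝓡 n) ∞ M] in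
theorem chartVolume_restrict_source (e : OpenPartialHomeomorph M (EuclideanSpace ℝ (Fin n))) :
    (chartVolume G e).restrict e.source = chartVolume G e := by
  ext A hA
  rw [Measure.restrict_apply hA, chartVolume_apply e (hA.inter e.open_source.measurableSet),
    chartVolume_apply e hA]
  congr 2
  ext p
  simp only [mem_inter_iff, mem_preimage]
  exact ⟨fun h => ⟨h.1, h.2.1⟩, fun h => ⟨h.1, h.2, e.map_target h.1⟩⟩

omit [IsManifold (𝓡 n) ∞ M] [MeasurableSpace M] [BorelSpace M] in
theorem exists_atlas_cover (n : ℕ) (M : Type*) [TopologicalSpace M] [SecondCountableTopology M]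
    [Nonempty M] [ChartedSpace (EuclideanSpace ℝ (Fin n)) M] :
    ∃ c : ℕ → OpenPartialHomeomorph M (EuclideanSpace ℝ (Fin n)),
      (∀ j, c j ∈ atlas (EuclideanSpace ℝ (Fin n)) M) ∧ ⋃ j, (c j).source = univ := by
  obtain ⟨s, hs, hcov⟩ := TopologicalSpace.countable_cover_nhds
    fun x : M => chart_source_mem_nhds (EuclideanSpace ℝ (Fin n)) x
  have hne : s.Nonempty := by
    obtain ⟨x⟩ := ‹Nonempty M›
    have : x ∈ ⋃ x ∈ s, (chartAt (EuclideanSpace ℝ (Fin n)) x).source := by rw [hcov]; trivial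
    obtain ⟨y, hy, -⟩ := mem_iUnion₂.1 this
    exact ⟨y, hy⟩
  obtain ⟨f, hf⟩ := hs.exists_eq_range hne
  refine ⟨fun j => chartAt _ (f j), fun j => chart_mem_atlas _ _, ?_⟩
  rw [← hcov, hf, biUnion_range]

variable [SecondCountableTopology M] [Nonempty M]

/-- On the domain of a chart the Hausdorff volume is given by the density in that chart. -/
theorem hausdorffVolume_restrict_source (he : e ∈ atlas (EuclideanSpace ℝ (Fin n)) M) :
    (hausdorffVolume G).restrict e.source = chartVolume G e := by
  obtain ⟨c, hc, hcov⟩ := exists_atlas_cover n M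
  let s : ℕ → Set M := disjointed fun j => (c j).source
  have hsm : ∀ j, MeasurableSet (s j) := fun j =>
    MeasurableSet.disjointed (fun i => (c i).open_source.measurableSet) j
  have hss : ∀ j, s j ⊆ (c j).source := fun j => disjointed_subset _ j
  have hsd : Pairwise (Function.onFun Disjoint s) := disjoint_disjointed _
  have hsu : ⋃ j, s j = univ := by rw [iUnion_disjointed, hcov]
  -- A measure glued along a countable disjoint refinement of the cover. It restricts to every chart
  -- measure, so it dominates the supremum, which is thereby kept from being too large on a chart
  -- domain.
  let ν : Measure M := Measure.sum fun j => (chartVolume G (c j)).restrict (s j)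
  have hν : ∀ e ∈ atlas (EuclideanSpace ℝ (Fin n)) M, ν.restrict e.source = chartVolume G e := by
    intro e he
    ext A hA
    have hAe := hA.inter e.open_source.measurableSet
    rw [Measure.restrict_apply hA, Measure.sum_apply _ hAe]
    have h1 : ∀ j, (chartVolume G (c j)).restrict (s j) (A ∩ e.source)
        = chartVolume G e (A ∩ e.source ∩ s j) := fun j => by
      rw [Measure.restrict_apply hAe]
      exact chartVolume_restrict_comm (hc j) he (hAe.inter (hsm j))
        (inter_subset_right.trans (hss j)) (inter_subset_left.trans inter_subset_right)
    simp only [h1]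
    rw [← measure_iUnion (fun i j hij => (hsd hij).mono inter_subset_right inter_subset_right)
      (fun j => hAe.inter (hsm j)), ← inter_iUnion, hsu, inter_univ, ← Measure.restrict_apply hA,
      chartVolume_restrict_source]
  have hle : hausdorffVolume G ≤ ν := iSup₂_le fun e he => (hν e he).symm.le.trans
    Measure.restrict_le_self
  refine le_antisymm ((Measure.restrict_mono le_rfl hle).trans (hν e he).le) ?_
  rw [← chartVolume_restrict_source]
  exact Measure.restrict_mono le_rfl
    (le_iSup₂ (f := fun e (_ : e ∈ atlas (EuclideanSpace ℝ (Fin n)) M) => chartVolume G e) e he)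

/-- A property that holds almost everywhere in a chart holds almost everywhere in its domain. -/
theorem ae_restrict_source_of_ae_target (he : e ∈ atlas (EuclideanSpace ℝ (Fin n)) M)
    {P : M → Prop} (h : ∀ᵐ p ∂volume.restrict e.target, P (e.symm p)) :
    ∀ᵐ x ∂(hausdorffVolume G).restrict e.source, P x := by
  rw [hausdorffVolume_restrict_source he]
  obtain ⟨N, hN, hNm, hN0⟩ := exists_measurable_superset_of_null h
  have hA := measurableSet_source_inter_preimage e hNm
  have h0 : chartVolume G e (e.source ∩ e ⁻¹' N) = 0 := by
    rw [chartVolume_apply e hA]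
    refine setLIntegral_measure_zero _ _ ?_
    rw [Measure.restrict_apply hNm] at hN0
    refine measure_mono_null (t := N ∩ e.target) (fun p hp => ⟨?_, hp.1⟩) hN0
    have := hp.2.2
    rwa [mem_preimage, e.right_inv hp.1] at this
  rw [← chartVolume_restrict_source, ae_restrict_iff' e.open_source.measurableSet]
  refine measure_mono_null (fun x hx => ?_) h0
  have hx' : ¬ (x ∈ e.source → P x) := hx
  push Not at hx'
  refine ⟨hx'.1, hN ?_⟩
  change ¬ P (e.symm (e x))
  rw [e.left_inv hx'.1]
  exact hx'.2

theorem ae_of_ae_charts {P : M → Prop} (h : ∀ e ∈ atlas (EuclideanSpace ℝ (Fin n)) M,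
    ∀ᵐ p ∂volume.restrict e.target, P (e.symm p)) : ∀ᵐ x ∂hausdorffVolume G, P x := by
  obtain ⟨c, hc, hcov⟩ := exists_atlas_cover n M
  rw [← Measure.restrict_univ (μ := hausdorffVolume G), ← hcov, ae_restrict_iUnion_iff]
  exact fun j => ae_restrict_source_of_ae_target (hc j) (h _ (hc j))

omit [MeasurableSpace M] [BorelSpace M] [SecondCountableTopology M] [Nonempty M] in
-- From a ‖y‖ ≤ G ≤ b ‖y‖ on K, the unit ball of G lies between the Euclidean balls of radii 1/b and
-- 1/a.
theorem exists_volumeDensity_bounds (hG : IsGauge G) (he : e ∈ atlas (EuclideanSpace ℝ (Fin n)) M)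
    {K : Set (EuclideanSpace ℝ (Fin n))} (hK : IsCompact K) (hKe : K ⊆ e.target) :
    ∃ c C : ℝ≥0∞, c ≠ 0 ∧ c ≠ ⊤ ∧ C ≠ ⊤ ∧
      ∀ p ∈ K, c ≤ volumeDensity G e p ∧ volumeDensity G e p ≤ C := by
  obtain ⟨a, b, ha, hb, hab⟩ := exists_chartMetric_bounds hG he hK hKe
  have hω0 : volume (Metric.ball (0 : EuclideanSpace ℝ (Fin n)) 1) ≠ 0 :=
    (Metric.measure_ball_pos _ _ one_pos).ne'
  have hω : volume (Metric.ball (0 : EuclideanSpace ℝ (Fin n)) 1) ≠ ⊤ := measure_ball_lt_top.ne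
  have hb0 : volume (Metric.ball (0 : EuclideanSpace ℝ (Fin n)) b⁻¹) ≠ 0 :=
    (Metric.measure_ball_pos _ _ (inv_pos.2 hb)).ne'
  have ha0 : volume (Metric.ball (0 : EuclideanSpace ℝ (Fin n)) a⁻¹) ≠ 0 :=
    (Metric.measure_ball_pos _ _ (inv_pos.2 ha)).ne'
  refine ⟨volume (Metric.ball (0 : EuclideanSpace ℝ (Fin n)) 1) /
      volume (Metric.ball (0 : EuclideanSpace ℝ (Fin n)) a⁻¹),
    volume (Metric.ball (0 : EuclideanSpace ℝ (Fin n)) 1) /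
      volume (Metric.ball (0 : EuclideanSpace ℝ (Fin n)) b⁻¹),
    (ENNReal.div_pos hω0 measure_ball_lt_top.ne).ne', ENNReal.div_ne_top hω ha0,
    ENNReal.div_ne_top hω hb0, fun p hp => ⟨?_, ?_⟩⟩
  · refine ENNReal.div_le_div_left (measure_mono fun y hy => ?_) _
    have hy' : chartMetric G e p y < 1 := hy
    rw [mem_ball_zero_iff, ← one_div, lt_div_iff₀ ha, mul_comm]
    exact (hab p hp y).1.trans_lt hy'
  · refine ENNReal.div_le_div_left (measure_mono fun y hy => ?_) _
    rw [mem_ball_zero_iff] at hy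
    change chartMetric G e p y < 1
    calc chartMetric G e p y ≤ b * ‖y‖ := (hab p hp y).2
      _ < b * b⁻¹ := by gcongr
      _ = 1 := mul_inv_cancel₀ hb.ne'

/-- Lebesgue measure on a compact subset of a chart is dominated by a multiple of the Hausdorff
volume. -/
theorem exists_map_volume_restrict_le (hG : IsGauge G)
    (he : e ∈ atlas (EuclideanSpace ℝ (Fin n)) M)
    {K : Set (EuclideanSpace ℝ (Fin n))} (hK : IsCompact K) (hKe : K ⊆ e.target) :
    ∃ C : ℝ≥0∞, C ≠ ⊤ ∧ Measure.map e.symm (volume.restrict K) ≤ C • hausdorffVolume G := by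
  obtain ⟨c, _, hc0, hc, _, h⟩ := exists_volumeDensity_bounds hG he hK hKe
  refine ⟨c⁻¹, ENNReal.inv_ne_top.2 hc0, ?_⟩
  refine Measure.le_iff.2 fun A hA => ?_
  have hKm := hK.measurableSet
  have hsub : (volume.restrict K : Measure (EuclideanSpace ℝ (Fin n)))
      ≤ volume.restrict e.target := Measure.restrict_mono hKe le_rfl
  rw [Measure.map_apply_of_aemeasurable ((aemeasurable_symm e).mono_measure hsub) hA,
    Measure.restrict_apply' hKm, Measure.smul_apply, smul_eq_mul, ← ENNReal.mul_le_iff_le_inv hc0 hc]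
  have hAm : MeasurableSet (e.symm ⁻¹' A ∩ K) := by
    have := (measurableSet_target_inter_preimage e hA).inter hKm
    convert this using 1
    ext p; simp only [mem_inter_iff]
    exact ⟨fun h => ⟨⟨hKe h.2, h.1⟩, h.2⟩, fun h => ⟨h.1.2, h.2⟩⟩
  calc c * volume (e.symm ⁻¹' A ∩ K) = ∫⁻ p in e.symm ⁻¹' A ∩ K, c := by
        rw [setLIntegral_const]
    _ ≤ ∫⁻ p in e.symm ⁻¹' A ∩ K, volumeDensity G e p :=
        setLIntegral_mono' hAm fun p hp => (h p hp.2).1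
    _ ≤ ∫⁻ p in e.target ∩ e.symm ⁻¹' A, volumeDensity G e p :=
        lintegral_mono_set fun p hp => ⟨hKe hp.2, hp.1⟩
    _ = chartVolume G e A := (chartVolume_apply e hA).symm
    _ ≤ hausdorffVolume G A := by
        rw [← hausdorffVolume_restrict_source he]
        exact Measure.restrict_le_self A

/-- The density is bounded away from zero on compact sets, so null sets for the Hausdorff volume are
Lebesgue null in every chart. -/
theorem ae_target_of_ae (hG : IsGauge G) (he : e ∈ atlas (EuclideanSpace ℝ (Fin n)) M)
    {P : M → Prop} (h : ∀ᵐ x ∂hausdorffVolume G, P x) :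
    ∀ᵐ p ∂volume.restrict e.target, P (e.symm p) := by
  obtain ⟨K, hK, hKu⟩ := exists_isCompact_iUnion_eq e.open_target
  rw [← hKu, ae_restrict_iUnion_iff]
  intro i
  have hKe : K i ⊆ e.target := hKu ▸ subset_iUnion K i
  obtain ⟨C, -, hC⟩ := exists_map_volume_restrict_le hG he (hK i) hKe
  have hac : Measure.map e.symm (volume.restrict (K i)) ≪ hausdorffVolume G :=
    (Measure.absolutelyContinuous_of_le hC).trans Measure.smul_absolutelyContinuous
  exact ae_of_ae_map ((aemeasurable_symm e).mono_measure (Measure.restrict_mono hKe le_rfl))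
    (hac h)

theorem aemeasurable_chart (hG : IsGauge G) (he : e ∈ atlas (EuclideanSpace ℝ (Fin n)) M)
    {Y : Type*} [MeasurableSpace Y] {f : M → Y} (hf : AEMeasurable f (hausdorffVolume G)) :
    AEMeasurable (fun p => f (e.symm p)) (volume.restrict e.target) := by
  obtain ⟨g, hg, hfg⟩ := hf
  exact (hg.comp_aemeasurable (aemeasurable_symm e)).congr
    ((ae_target_of_ae hG he hfg).mono fun p hp => hp.symm)

theorem aemeasurable_restrict_source (he : e ∈ atlas (EuclideanSpace ℝ (Fin n)) M)
    {Y : Type*} [MeasurableSpace Y] {f : M → Y}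
    (hf : AEMeasurable (fun p => f (e.symm p)) (volume.restrict e.target)) :
    AEMeasurable f ((hausdorffVolume G).restrict e.source) := by
  obtain ⟨g, hg, hfg⟩ := hf
  have h1 : AEMeasurable e ((hausdorffVolume G).restrict e.source) :=
    e.continuousOn.aemeasurable e.open_source.measurableSet
  have h2 : ∀ᵐ x ∂(hausdorffVolume G).restrict e.source, f x = g (e x) := by
    refine ae_restrict_source_of_ae_target he ?_
    filter_upwards [hfg, ae_restrict_mem e.open_target.measurableSet] with p hp hpt
    rw [hp, e.right_inv hpt]
  exact (hg.comp_aemeasurable h1).congr (h2.mono fun x hx => hx.symm)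

theorem aemeasurable_of_charts {Y : Type*} [MeasurableSpace Y] {f : M → Y}
    (hf : ∀ e ∈ atlas (EuclideanSpace ℝ (Fin n)) M,
      AEMeasurable (fun p => f (e.symm p)) (volume.restrict e.target)) :
    AEMeasurable f (hausdorffVolume G) := by
  obtain ⟨c, hc, hcov⟩ := exists_atlas_cover n M
  rw [← Measure.restrict_univ (μ := hausdorffVolume G), ← hcov, aemeasurable_iUnion_iff]
  exact fun j => aemeasurable_restrict_source (hc j) (hf _ (hc j))

theorem isLocallyFiniteMeasure_hausdorffVolume (hG : IsGauge G) :
    IsLocallyFiniteMeasure (hausdorffVolume G) := by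
  refine ⟨fun x => ?_⟩
  set e := chartAt (EuclideanSpace ℝ (Fin n)) x with he_def
  have he : e ∈ atlas (EuclideanSpace ℝ (Fin n)) M := chart_mem_atlas _ _
  have hx : x ∈ e.source := mem_chart_source _ x
  obtain ⟨K, hK, hKx, hKe⟩ := exists_compact_subset e.open_target (e.map_source hx)
  obtain ⟨_, C, _, _, hC, h⟩ := exists_volumeDensity_bounds hG he hK hKe
  have hU : IsOpen (e.source ∩ e ⁻¹' interior K) := e.isOpen_inter_preimage isOpen_interior
  refine ⟨e.source ∩ e ⁻¹' interior K, hU.mem_nhds ⟨hx, hKx⟩, ?_⟩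
  have h1 : hausdorffVolume G (e.source ∩ e ⁻¹' interior K)
      = chartVolume G e (e.source ∩ e ⁻¹' interior K) := by
    rw [← hausdorffVolume_restrict_source he, Measure.restrict_apply hU.measurableSet]
    congr 1
    exact (inter_eq_left.2 inter_subset_left).symm
  rw [h1, chartVolume_apply e hU.measurableSet]
  calc ∫⁻ p in e.target ∩ e.symm ⁻¹' (e.source ∩ e ⁻¹' interior K), volumeDensity G e p
      ≤ ∫⁻ p in K, volumeDensity G e p := by
        refine lintegral_mono_set fun p hp => interior_subset ?_
        have := hp.2.2
        rwa [mem_preimage, e.right_inv hp.1] at this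
    _ ≤ ∫⁻ p in K, C := setLIntegral_mono' hK.measurableSet fun p hp => (h p hp).2
    _ < ⊤ := by
        rw [setLIntegral_const]
        exact ENNReal.mul_lt_top hC.lt_top hK.measure_lt_top

end Measure

/-! ### The polar transform -/

section Polar

variable [IsManifold (𝓡 n) ∞ M] {G G' : TangentBundle (𝓡 n) M → ℝ}

theorem IsGauge.continuous_fiber (hG : IsGauge G) (x : M) :
    Continuous fun y : EuclideanSpace ℝ (Fin n) => G ⟨x, y⟩ :=
  hG.continuous.comp (FiberBundle.continuous_totalSpaceMk (EuclideanSpace ℝ (Fin n))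
    (TangentSpace (𝓡 n) : M → Type _) x)

/-- A real supremum over an unbounded set would be the default value 0; boundedness makes the polar
transform a true supremum. -/
theorem IsGauge.bddAbove_polar (hG : IsGauge G) (x : M) (α : TangentSpace (𝓡 n) x →L[ℝ] ℝ) :
    BddAbove (range fun y : {y : TangentSpace (𝓡 n) x // y ≠ 0} => α y / G ⟨x, y⟩) := by
  obtain ⟨a, ha, h⟩ := exists_pos_mul_norm_le (hG.continuous_fiber x) (hG.homogeneous x) (hG.pos x)
  let β : EuclideanSpace ℝ (Fin n) →L[ℝ] ℝ := α
  refine ⟨‖β‖ / a, ?_⟩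
  rintro _ ⟨⟨y, hy⟩, rfl⟩
  let y' : EuclideanSpace ℝ (Fin n) := y
  have h1 : a * ‖y'‖ ≤ G ⟨x, y⟩ := h y
  have h2 : α y ≤ ‖β‖ * ‖y'‖ :=
    (le_abs_self _).trans (β.le_opNorm y')
  change α y / G ⟨x, y⟩ ≤ _
  rw [div_le_div_iff₀ (hG.pos x y hy) ha]
  calc α y * a ≤ (‖β‖ * ‖y'‖) * a := by gcongr
    _ = ‖β‖ * (a * ‖y'‖) := by ring
    _ ≤ ‖β‖ * G ⟨x, y⟩ := by gcongr

theorem IsGauge.le_polar_mul (hG : IsGauge G) (x : M) (α : TangentSpace (𝓡 n) x →L[ℝ] ℝ)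
    (y : TangentSpace (𝓡 n) x) : α y ≤ polar G x α * G ⟨x, y⟩ := by
  rcases eq_or_ne y 0 with rfl | hy
  · simp [hG.zero]
  · rw [← div_le_iff₀ (hG.pos x y hy)]
    exact le_ciSup (hG.bddAbove_polar x α) ⟨y, hy⟩

/-- The condition 0 ≤ c covers a zero tangent space, where the supremum is over the empty set and
equals 0. -/
theorem IsGauge.polar_le (hG : IsGauge G) {x : M} {α : TangentSpace (𝓡 n) x →L[ℝ] ℝ} {c : ℝ}
    (hc : 0 ≤ c) (h : ∀ y, α y ≤ c * G ⟨x, y⟩) : polar G x α ≤ c :=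
  Real.iSup_le (fun y => (div_le_iff₀ (hG.pos x y y.2)).2 (h y)) hc

/-- A negative supremum would force α(y) < 0 and α(-y) < 0 at once. -/
theorem IsGauge.polar_nonneg (hG : IsGauge G) (x : M) (α : TangentSpace (𝓡 n) x →L[ℝ] ℝ) :
    0 ≤ polar G x α := by
  by_cases h : ∃ y : TangentSpace (𝓡 n) x, y ≠ 0
  · obtain ⟨y, hy⟩ := h
    have h1 := hG.le_polar_mul x α y
    have h2 := hG.le_polar_mul x α (-y)
    rw [map_neg] at h2
    have h3 := hG.pos x y hy
    have h4 := hG.pos x (-y) (neg_ne_zero.2 hy)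
    by_contra hneg
    push Not at hneg
    nlinarith
  · have : IsEmpty {y : TangentSpace (𝓡 n) x // y ≠ 0} := ⟨fun y => h ⟨y, y.2⟩⟩
    simp [polar]

theorem IsGauge.polar_add_le (hG : IsGauge G) (x : M) (α β : TangentSpace (𝓡 n) x →L[ℝ] ℝ) :
    polar G x (α + β) ≤ polar G x α + polar G x β := by
  refine hG.polar_le (add_nonneg (hG.polar_nonneg x α) (hG.polar_nonneg x β)) fun y => ?_
  rw [add_mul]
  exact add_le_add (hG.le_polar_mul x α y) (hG.le_polar_mul x β y)

theorem IsGauge.polar_zero (hG : IsGauge G) (x : M) : polar G x 0 = 0 :=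
  le_antisymm (hG.polar_le le_rfl fun y => by simp) (hG.polar_nonneg x 0)

theorem IsGauge.polar_smul_le (hG : IsGauge G) (x : M) (α : TangentSpace (𝓡 n) x →L[ℝ] ℝ) {c : ℝ}
    (hc : 0 ≤ c) : polar G x (c • α) ≤ c * polar G x α := by
  refine hG.polar_le (mul_nonneg hc (hG.polar_nonneg x α)) fun y => ?_
  rw [mul_assoc]
  exact mul_le_mul_of_nonneg_left (hG.le_polar_mul x α y) hc

theorem IsGauge.polar_smul (hG : IsGauge G) (x : M) (α : TangentSpace (𝓡 n) x →L[ℝ] ℝ) {c : ℝ}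
    (hc : 0 ≤ c) : polar G x (c • α) = c * polar G x α := by
  rcases hc.eq_or_lt with rfl | hc'
  · simp [hG.polar_zero]
  · refine le_antisymm (hG.polar_smul_le x α hc) ?_
    have h := hG.polar_smul_le x (c • α) (inv_nonneg.2 hc)
    rwa [smul_smul, inv_mul_cancel₀ hc'.ne', one_smul, inv_mul_eq_div, le_div_iff₀ hc',
      mul_comm] at h

/-- The polar transform reverses inequalities. -/
theorem IsGauge.polar_le_mul_polar (hG : IsGauge G) (hG' : IsGauge G') {k : ℝ} (hk : 0 ≤ k) {x : M}
    (h : ∀ y, G ⟨x, y⟩ ≤ k * G' ⟨x, y⟩) (α : TangentSpace (𝓡 n) x →L[ℝ] ℝ) :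
    polar G' x α ≤ k * polar G x α := by
  refine hG'.polar_le (mul_nonneg hk (hG.polar_nonneg x α)) fun y => ?_
  calc α y ≤ polar G x α * G ⟨x, y⟩ := hG.le_polar_mul x α y
    _ ≤ polar G x α * (k * G' ⟨x, y⟩) := mul_le_mul_of_nonneg_left (h y) (hG.polar_nonneg x α)
    _ = k * polar G x α * G' ⟨x, y⟩ := by ring

theorem IsGauge.polar_neg_le (hG : IsGauge G) {k : ℝ} (hk : 0 ≤ k) {x : M}
    (h : ∀ y : TangentSpace (𝓡 n) x, G ⟨x, -y⟩ ≤ k * G ⟨x, y⟩)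
    (α : TangentSpace (𝓡 n) x →L[ℝ] ℝ) : polar G x (-α) ≤ k * polar G x α := by
  refine hG.polar_le (mul_nonneg hk (hG.polar_nonneg x α)) fun y => ?_
  calc (-α) y = α (-y) := by simp
    _ ≤ polar G x α * G ⟨x, -y⟩ := hG.le_polar_mul x α (-y)
    _ ≤ polar G x α * (k * G ⟨x, y⟩) := mul_le_mul_of_nonneg_left (h y) (hG.polar_nonneg x α)
    _ = k * polar G x α * G ⟨x, y⟩ := by ring

theorem IsGauge.abs_le_polar_mul (hG : IsGauge G) {x : M}
    (hsymm : ∀ y : TangentSpace (𝓡 n) x, G ⟨x, -y⟩ = G ⟨x, y⟩)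
    (α : TangentSpace (𝓡 n) x →L[ℝ] ℝ) (y : TangentSpace (𝓡 n) x) :
    |α y| ≤ polar G x α * G ⟨x, y⟩ := by
  refine abs_le'.2 ⟨hG.le_polar_mul x α y, ?_⟩
  rw [← map_neg, ← hsymm]
  exact hG.le_polar_mul x α (-y)

end Polar

/-! ### Measurable covector fields and frames -/

section Covector

variable [IsManifold (𝓡 n) ∞ M] [MeasurableSpace M] [BorelSpace M] [SecondCountableTopology M]
  [Nonempty M] {F G : TangentBundle (𝓡 n) M → ℝ}
  {θ η : (x : M) → TangentSpace (𝓡 n) x →L[ℝ] ℝ}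

/-- The components of the covector field `θ` in every chart are almost everywhere measurable. -/
def AEMeasurableCovector (θ : (x : M) → TangentSpace (𝓡 n) x →L[ℝ] ℝ) : Prop :=
  ∀ e ∈ atlas (EuclideanSpace ℝ (Fin n)) M, ∀ v : EuclideanSpace ℝ (Fin n),
    AEMeasurable (fun p => θ (e.symm p) (chartVector e p v)) (volume.restrict e.target)

omit [IsManifold (𝓡 n) ∞ M] [MeasurableSpace M] [BorelSpace M] [SecondCountableTopology M]
  [Nonempty M] in
theorem AEMeasurableCovector.add (hθ : AEMeasurableCovector θ) (hη : AEMeasurableCovector η) :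
    AEMeasurableCovector (fun x => θ x + η x) :=
  fun e he v => (hθ e he v).add (hη e he v)

omit [IsManifold (𝓡 n) ∞ M] [MeasurableSpace M] [BorelSpace M] [SecondCountableTopology M]
  [Nonempty M] in
theorem AEMeasurableCovector.smul (hθ : AEMeasurableCovector θ) (c : ℝ) :
    AEMeasurableCovector (fun x => c • θ x) :=
  fun e he v => (hθ e he v).const_mul c

theorem AEMeasurableCovector.of_tendsto (hF : IsGauge F)
    {θk : ℕ → (x : M) → TangentSpace (𝓡 n) x →L[ℝ] ℝ}
    (hθ : ∀ k, AEMeasurableCovector (θk k))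
    (h : ∀ᵐ x ∂hausdorffVolume F, ∀ v, Tendsto (fun k => θk k x v) atTop (𝓝 (θ x v))) :
    AEMeasurableCovector θ := fun e he v =>
  aemeasurable_of_tendsto_metrizable_ae atTop (fun k => hθ k e he v)
    ((ae_target_of_ae hF he h).mono fun p hp => hp (chartVector e p v))

/-- In a chart the supremum over all vectors equals the one over a countable dense sequence, by
continuity of α and G on the fibre. A zero vector in the sequence contributes 0/0 = 0, which is
harmless since the polar transform is nonnegative. -/
theorem AEMeasurableCovector.polar (hG : IsGauge G) (hθ : AEMeasurableCovector θ) :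
    AEMeasurable (fun x => polar G x (θ x)) (hausdorffVolume F) := by
  refine aemeasurable_of_charts fun e he => ?_
  let d := TopologicalSpace.denseSeq (EuclideanSpace ℝ (Fin n))
  have hd : DenseRange d := TopologicalSpace.denseRange_denseSeq _
  have hmet : ∀ y, AEMeasurable (fun p => chartMetric G e p y) (volume.restrict e.target) :=
    fun y => ((continuousOn_chartMetric hG he).comp (s := e.target) (f := fun p => (p, y))
      (by fun_prop) (fun p hp => ⟨hp, mem_univ _⟩)).aemeasurable e.open_target.measurableSet
  have hsup : AEMeasurable (fun p => ⨆ k, θ (e.symm p) (chartVector e p (d k)) /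
      chartMetric G e p (d k)) (volume.restrict e.target) :=
    AEMeasurable.iSup fun k => (hθ e he (d k)).div (hmet (d k))
  refine hsup.congr ?_
  filter_upwards [ae_restrict_mem e.open_target.measurableSet] with p hp
  have hle : ∀ k, θ (e.symm p) (chartVector e p (d k)) / chartMetric G e p (d k)
      ≤ Finsler.polar G (e.symm p) (θ (e.symm p)) := fun k => by
    by_cases h0 : d k = 0
    · have : chartVector e p 0 = 0 :=
        map_zero (mfderiv 𝓘(ℝ, EuclideanSpace ℝ (Fin n)) (𝓡 n) e.symm p)
      rw [h0, this]; simpa using hG.polar_nonneg _ _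
    · rw [div_le_iff₀ (chartMetric_pos hG he hp h0)]
      exact hG.le_polar_mul _ _ _
  have hbdd : BddAbove (range fun k => θ (e.symm p) (chartVector e p (d k)) /
      chartMetric G e p (d k)) := ⟨_, by rintro _ ⟨k, rfl⟩; exact hle k⟩
  refine le_antisymm (ciSup_le hle) ?_
  set S := ⨆ k, θ (e.symm p) (chartVector e p (d k)) / chartMetric G e p (d k) with hS
  have hineq : ∀ y, θ (e.symm p) (chartVector e p y) ≤ S * chartMetric G e p y := by
    intro y
    have hc1 : Continuous fun y => θ (e.symm p) (chartVector e p y) :=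
      (θ (e.symm p)).continuous.comp
        (mfderiv 𝓘(ℝ, EuclideanSpace ℝ (Fin n)) (𝓡 n) e.symm p).continuous
    have hc2 : Continuous fun y => chartMetric G e p y :=
      (hG.continuous_fiber (e.symm p)).comp
        (mfderiv 𝓘(ℝ, EuclideanSpace ℝ (Fin n)) (𝓡 n) e.symm p).continuous
    refine hd.induction_on y (isClosed_le hc1 (continuous_const.mul hc2)) fun k => ?_
    by_cases h0 : d k = 0
    · have : chartVector e p 0 = 0 :=
        map_zero (mfderiv 𝓘(ℝ, EuclideanSpace ℝ (Fin n)) (𝓡 n) e.symm p)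
      rw [h0, chartMetric, this, hG.zero]; simp
    · rw [← div_le_iff₀ (chartMetric_pos hG he hp h0)]
      exact le_ciSup hbdd k
  have hS0 : 0 ≤ S := by
    by_contra hneg
    push Not at hneg
    obtain ⟨k, hk⟩ | hall : (∃ k, d k ≠ 0) ∨ ∀ k, d k = 0 := by
      by_contra h; push Not at h; exact h.2.elim fun k hk => hk (h.1 k)
    · have h1 := hineq (d k)
      have h2 := hineq (-d k)
      rw [show -d k = (-1 : ℝ) • d k by simp, chartVector_smul, map_smul] at h2
      have h3 := chartMetric_pos hG he hp hk
      have h4 := chartMetric_pos (y := (-1 : ℝ) • d k) hG he hp (by simpa using hk)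
      simp only [smul_eq_mul] at h2
      nlinarith
    · have : S = 0 := by
        have h0 : chartVector e p 0 = 0 :=
          map_zero (mfderiv 𝓘(ℝ, EuclideanSpace ℝ (Fin n)) (𝓡 n) e.symm p)
        simp [hS, hall, h0]
      exact hneg.ne this
  refine hG.polar_le hS0 fun w => ?_
  obtain ⟨y, rfl⟩ := (chartVector_bijective he hp).2 w
  exact hineq y

/-- There is a frame of vector fields, measurable in the sense that it pairs measurably with
measurable covector fields, whose members have `G`-length one and with respect to which the
coefficients of every vector are bounded by its `G`-length. -/
theorem exists_adapted_frame (hG : IsGauge G) :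
    ∃ Y : Fin n → (x : M) → TangentSpace (𝓡 n) x,
      (∀ i x, G ⟨x, Y i x⟩ = 1) ∧
      (∀ x y, ∃ c : Fin n → ℝ, y = ∑ i, c i • Y i x ∧ ∀ i, |c i| ≤ 2 * G ⟨x, y⟩) ∧
      ∀ θ : (x : M) → TangentSpace (𝓡 n) x →L[ℝ] ℝ, AEMeasurableCovector θ →
        ∀ i, AEMeasurable (fun x => θ x (Y i x)) (hausdorffVolume F) := by
  classical
  obtain ⟨c, hc, hcov⟩ := exists_atlas_cover n M
  have hex : ∀ x, ∃ j, x ∈ (c j).source := fun x => by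
    have : x ∈ ⋃ j, (c j).source := by rw [hcov]; trivial
    exact mem_iUnion.1 this
  -- Using the first chart of a countable cover that contains x gives coordinates on all of M,
  -- measurable though not continuous; the frame is built in these coordinates.
  let idx : M → ℕ := fun x => Nat.find (hex x)
  have hidx : ∀ x, x ∈ (c (idx x)).source := fun x => Nat.find_spec (hex x)
  have hidxm : Measurable idx :=
    measurable_find hex fun j => (c j).open_source.measurableSet
  have htgt : ∀ x, c (idx x) x ∈ (c (idx x)).target := fun x => (c (idx x)).map_source (hidx x)
  -- The base point on the left is x sent through the chart and back; all fibres are the same model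
  -- space, so only the base point is replaced.
  have hlen : ∀ j x y, x ∈ (c j).source → chartMetric G (c j) (c j x) y
      = G ⟨x, (chartVector (c j) (c j x) y : EuclideanSpace ℝ (Fin n))⟩ := by
    intro j x y hx
    have aux : ∀ x' (v : EuclideanSpace ℝ (Fin n)), x' = x →
        G (⟨x', v⟩ : TangentBundle (𝓡 n) M) = G ⟨x, v⟩ := by rintro _ v rfl; rfl
    exact aux _ _ ((c j).left_inv hx)
  obtain ⟨z, hzm, hz1, hz⟩ := exists_measurable_frame (X := M)
    (fun x y => chartMetric G (c (idx x)) (c (idx x) x) y)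
    (fun y => by
      have hm : ∀ j, Measurable fun x =>
          (c j).source.piecewise (fun x => chartMetric G (c j) (c j x) y) 0 x := fun j => by
        refine ContinuousOn.measurable_piecewise ?_ continuousOn_const
          (c j).open_source.measurableSet
        exact (continuousOn_chartMetric hG (hc j)).comp (f := fun x => (c j x, y))
          ((c j).continuousOn.prodMk continuousOn_const)
          (fun x hx => ⟨(c j).map_source hx, mem_univ _⟩)
      have := Measurable.find (f := fun j x =>
          (c j).source.piecewise (fun x => chartMetric G (c j) (c j x) y) 0 x)
        (p := fun j x => x ∈ (c j).source) hm (fun j => (c j).open_source.measurableSet) hex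
      convert this using 2 with x
      exact (piecewise_eq_of_mem (c (idx x)).source
        (fun x' => chartMetric G (c (idx x)) (c (idx x) x') y) 0 (hidx x)).symm)
    (fun x => (hG.continuous_fiber _).comp
      (mfderiv 𝓘(ℝ, EuclideanSpace ℝ (Fin n)) (𝓡 n) (c (idx x)).symm (c (idx x) x)).continuous)
    (fun x y t ht => chartMetric_smul hG _ _ ht)
    (fun x y hy => chartMetric_pos hG (hc _) (htgt x) hy)
  let B : (x : M) → EuclideanSpace ℝ (Fin n) →L[ℝ] EuclideanSpace ℝ (Fin n) := fun x =>
    mfderiv 𝓘(ℝ, EuclideanSpace ℝ (Fin n)) (𝓡 n) (c (idx x)).symm (c (idx x) x)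
  have hB : ∀ x y, G ⟨x, B x y⟩ = chartMetric G (c (idx x)) (c (idx x) x) y := fun x y =>
    (hlen (idx x) x y (hidx x)).symm
  refine ⟨fun i x => B x (z i x), fun i x => ?_, fun x y => ?_, fun θ hθ i => ?_⟩
  · exact (hB x _).trans (hz1 x i)
  · obtain ⟨w, hw⟩ := (chartVector_bijective (hc _) (htgt x)).2 y
    have hw' : B x w = y := hw
    obtain ⟨a, ha, hab⟩ := hz x w
    refine ⟨a, ?_, fun i => ?_⟩
    · conv_lhs => rw [← hw', ha, map_sum]
      exact Finset.sum_congr rfl fun i _ => map_smul _ _ _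
    · rw [← hw', hB]
      exact hab i
  · have hbasis : ∀ v, AEMeasurable (fun x => θ x (B x v)) (hausdorffVolume F) := by
      intro v
      have hU : ⋃ j, idx ⁻¹' {j} = univ := by ext x; simp
      rw [← Measure.restrict_univ (μ := hausdorffVolume F), ← hU, aemeasurable_iUnion_iff]
      intro j
      have hsub : idx ⁻¹' {j} ⊆ (c j).source := fun x hx => by
        have : idx x = j := hx
        rw [← this]; exact hidx x
      have h1 : AEMeasurable (fun x => θ x (mfderiv 𝓘(ℝ, EuclideanSpace ℝ (Fin n)) (𝓡 n)
          (c j).symm (c j x) v : EuclideanSpace ℝ (Fin n)))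
          ((hausdorffVolume F).restrict (c j).source) := by
        refine aemeasurable_restrict_source (hc j) ((hθ (c j) (hc j) v).congr ?_)
        filter_upwards [ae_restrict_mem (c j).open_target.measurableSet] with p hp
        rw [(c j).right_inv hp]
        rfl
      refine (h1.mono_measure (Measure.restrict_mono hsub le_rfl)).congr ?_
      filter_upwards [ae_restrict_mem (hidxm (measurableSet_singleton j))] with x hx
      have : idx x = j := hx
      subst this
      rfl
    -- Expanding z i x in the standard basis leaves measurable coefficients times values of θ on
    -- coordinate fields.
    have hsum : ∀ x, θ x (B x (z i x))
        = ∑ l, (z i x) l * θ x (B x (EuclideanSpace.single l 1)) := fun x => by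
      have h1 : z i x = ∑ l, (z i x) l • EuclideanSpace.single l (1 : ℝ) := by
        have := (EuclideanSpace.basisFun (Fin n) ℝ).sum_repr (z i x)
        simpa using this.symm
      let L : EuclideanSpace ℝ (Fin n) →L[ℝ] ℝ :=
        ContinuousLinearMap.comp (θ x : EuclideanSpace ℝ (Fin n) →L[ℝ] ℝ) (B x)
      change L (z i x) = ∑ l, (z i x) l * L (EuclideanSpace.single l 1)
      conv_lhs => rw [h1, map_sum]
      simp
    simp only [hsum]
    refine Finset.aemeasurable_fun_sum _ fun l _ => AEMeasurable.mul ?_ (hbasis _)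
    exact ((EuclideanSpace.proj (𝕜 := ℝ) l).continuous.measurable.comp (hzm i)).aemeasurable

end Covector

/-! ### Integration against continuous functions with compact support -/

section Pairing

variable {E : Type*} [NormedAddCommGroup E] [MeasurableSpace E] [BorelSpace E] {μ : Measure E}
  [IsLocallyFiniteMeasure μ] {f : E → ℝ} {ψ : E → ℝ} {K : Set E}

theorem integrable_mul_of_memLp (hK : IsCompact K) (hf : MemLp f 2 (μ.restrict K))
    (hψ : Continuous ψ) (hψK : ∀ p, p ∉ K → ψ p = 0) : Integrable (fun p => f p * ψ p) μ := by
  have : IsFiniteMeasure (μ.restrict K) := ⟨by simpa using hK.measure_lt_top⟩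
  have h1 : IntegrableOn f K μ := hf.integrable one_le_two
  refine (integrableOn_iff_integrable_of_support_subset fun p hp => ?_).1
    (h1.mul_continuousOn hψ.continuousOn hK)
  by_contra hpK
  exact hp (by simp [hψK p hpK])

/-- Cauchy–Schwarz on K. It is the passage to the limit on both sides of the weak formulation. -/
theorem tendsto_integral_mul_of_memLp {fk : ℕ → E → ℝ} (hK : IsCompact K)
    (hfk : ∀ k, MemLp (fk k) 2 (μ.restrict K)) (hf : MemLp f 2 (μ.restrict K))
    (h : Tendsto (fun k => eLpNorm (fk k - f) 2 (μ.restrict K)) atTop (𝓝 0))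
    (hψ : Continuous ψ) (hψK : ∀ p, p ∉ K → ψ p = 0) :
    Tendsto (fun k => ∫ p, fk k p * ψ p ∂μ) atTop (𝓝 (∫ p, f p * ψ p ∂μ)) := by
  have : IsFiniteMeasure (μ.restrict K) := ⟨by simpa using hK.measure_lt_top⟩
  have hset : ∀ g : E → ℝ, ∫ p, g p * ψ p ∂μ = ∫ p in K, g p * ψ p ∂μ := fun g =>
    (setIntegral_eq_integral_of_forall_compl_eq_zero fun p hp => by rw [hψK p hp, mul_zero]).symm
  simp only [hset]
  obtain ⟨C, hC⟩ := hK.exists_bound_of_continuousOn hψ.continuousOn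
  have hψ2 : MemLp ψ 2 (μ.restrict K) :=
    MemLp.of_bound (hψ.continuousOn.aestronglyMeasurable hK.measurableSet) C
      (ae_restrict_of_forall_mem hK.measurableSet hC)
  refine tendsto_integral_of_L1' _ (integrable_mul_of_memLp hK hf hψ hψK).1.restrict
    (Eventually.of_forall fun k => (integrable_mul_of_memLp hK (hfk k) hψ hψK).integrableOn) ?_
  have hle : ∀ k, eLpNorm ((fun p => fk k p * ψ p) - fun p => f p * ψ p) 1 (μ.restrict K)
      ≤ eLpNorm (fk k - f) 2 (μ.restrict K) * eLpNorm ψ 2 (μ.restrict K) := fun k => by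
    have := eLpNorm_smul_le_mul_eLpNorm (p := 2) (q := 2) (r := 1) hψ2.1 ((hfk k).sub hf).1
    convert this using 2
    ext p
    simp [sub_mul]
  refine tendsto_of_tendsto_of_tendsto_of_le_of_le tendsto_const_nhds ?_
    (fun k => zero_le) hle
  simpa using ENNReal.Tendsto.mul_const h (Or.inr hψ2.2.ne)

end Pairing

/-! ### Weak differentials -/

section WeakDifferential

variable [IsManifold (𝓡 n) ∞ M] {u w : M → ℝ}
  {θ η : (x : M) → TangentSpace (𝓡 n) x →L[ℝ] ℝ}
  {e : OpenPartialHomeomorph M (EuclideanSpace ℝ (Fin n))} {F G : TangentBundle (𝓡 n) M → ℝ}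

theorem continuous_fderiv_apply {E : Type*} [NormedAddCommGroup E] [NormedSpace ℝ E] {φ : E → ℝ}
    (hφ : ContDiff ℝ ∞ φ) (v : E) : Continuous fun p => fderiv ℝ φ p v :=
  (hφ.continuous_fderiv (by simp)).clm_apply continuous_const

theorem fderiv_apply_eq_zero_of_notMem_tsupport {E : Type*} [NormedAddCommGroup E]
    [NormedSpace ℝ E] {φ : E → ℝ} {p : E} (hp : p ∉ tsupport φ) (v : E) : fderiv ℝ φ p v = 0 := by
  have : φ =ᶠ[𝓝 p] 0 := notMem_tsupport_iff_eventuallyEq.1 hp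
  rw [this.fderiv_eq]
  simp

theorem HasWeakDifferential.add (hu : HasWeakDifferential u θ) (hw : HasWeakDifferential w η) :
    HasWeakDifferential (fun x => u x + w x) (fun x => θ x + η x) where
  memLp e he K hK hKc := (hu.memLp e he K hK hKc).add (hw.memLp e he K hK hKc)
  memLp_differential e he K hK hKc v :=
    (hu.memLp_differential e he K hK hKc v).add (hw.memLp_differential e he K hK hKc v)
  integral_eq e he φ hφ hφc hφe v := by
    have hz : ∀ p, p ∉ tsupport φ → φ p = 0 := fun p hp => image_eq_zero_of_notMem_tsupport hp
    have hz' : ∀ p, p ∉ tsupport φ → fderiv ℝ φ p v = 0 := fun p hp =>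
      fderiv_apply_eq_zero_of_notMem_tsupport hp v
    have i1 := integrable_mul_of_memLp (μ := volume) hφc (hu.memLp e he _ hφe hφc)
      (continuous_fderiv_apply hφ v) hz'
    have i2 := integrable_mul_of_memLp (μ := volume) hφc (hw.memLp e he _ hφe hφc)
      (continuous_fderiv_apply hφ v) hz'
    have i3 := integrable_mul_of_memLp (μ := volume) hφc
      (hu.memLp_differential e he _ hφe hφc v) hφ.continuous hz
    have i4 := integrable_mul_of_memLp (μ := volume) hφc
      (hw.memLp_differential e he _ hφe hφc v) hφ.continuous hz
    simp only [add_mul, add_apply]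
    rw [integral_add i1 i2, integral_add i3 i4, hu.integral_eq e he φ hφ hφc hφe v,
      hw.integral_eq e he φ hφ hφc hφe v, neg_add]

theorem HasWeakDifferential.smul (hu : HasWeakDifferential u θ) (c : ℝ) :
    HasWeakDifferential (fun x => c * u x) (fun x => c • θ x) where
  memLp e he K hK hKc := (hu.memLp e he K hK hKc).const_mul c
  memLp_differential e he K hK hKc v := (hu.memLp_differential e he K hK hKc v).const_mul c
  integral_eq e he φ hφ hφc hφe v := by
    simp only [smul_apply, smul_eq_mul, mul_assoc]
    rw [integral_const_mul, integral_const_mul, hu.integral_eq e he φ hφ hφc hφe v, mul_neg]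

theorem hasWeakDifferential_zero :
    HasWeakDifferential (n := n) (fun _ : M => (0 : ℝ)) (fun _ => 0) where
  memLp e he K hK hKc := by simp
  memLp_differential e he K hK hKc v := by simp
  integral_eq e he φ hφ hφc hφe v := by simp

theorem HasWeakDifferential.aemeasurableCovector (hu : HasWeakDifferential u θ) :
    AEMeasurableCovector θ := by
  intro e he v
  obtain ⟨K, hK, hKu⟩ := exists_isCompact_iUnion_eq e.open_target
  rw [← hKu, aemeasurable_iUnion_iff]
  exact fun i => (hu.memLp_differential e he (K i) (hKu ▸ subset_iUnion K i) (hK i) v).1.aemeasurable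

/-- The differential of a function on the manifold. -/
def differential (φ : M → ℝ) : (x : M) → TangentSpace (𝓡 n) x →L[ℝ] ℝ :=
  fun x => mfderiv (𝓡 n) 𝓘(ℝ, ℝ) φ x

/-- A smooth function has its differential as weak differential. -/
theorem hasWeakDifferential_of_contMDiff {φ : M → ℝ} (hφ : ContMDiff (𝓡 n) 𝓘(ℝ, ℝ) ∞ φ) :
    HasWeakDifferential (n := n) φ (differential φ) := by
  have hsm : ∀ e ∈ atlas (EuclideanSpace ℝ (Fin n)) M, ContDiffOn ℝ ∞ (φ ∘ e.symm) e.target :=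
    fun e he => (hφ.comp_contMDiffOn (contMDiffOn_symm_of_mem_maximalAtlas
      (IsManifold.subset_maximalAtlas he))).contDiffOn
  have hder : ∀ e ∈ atlas (EuclideanSpace ℝ (Fin n)) M, ∀ p ∈ e.target, ∀ v,
      differential φ (e.symm p) (chartVector e p v)
        = fderiv ℝ (φ ∘ e.symm) p v := by
    intro e he p hp v
    have h := mfderiv_comp p (hφ.mdifferentiableAt (x := e.symm p) (by simp))
      ((mdifferentiable_atlas he).mdifferentiableAt_symm hp)
    rw [← mfderiv_eq_fderiv]
    exact (congrArg (fun L => L v) h).symm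
  have hcont : ∀ e ∈ atlas (EuclideanSpace ℝ (Fin n)) M, ∀ v,
      ContinuousOn (fun p => differential φ (e.symm p) (chartVector e p v)) e.target := fun e he v =>
    (((hsm e he).continuousOn_fderiv_of_isOpen e.open_target (by simp)).clm_apply
      continuousOn_const).congr fun p hp => hder e he p hp v
  have hmem : ∀ {f : EuclideanSpace ℝ (Fin n) → ℝ} {U K : Set (EuclideanSpace ℝ (Fin n))},
      ContinuousOn f U → K ⊆ U → IsCompact K → MemLp f 2 (volume.restrict K) := by
    intro f U K hf hKU hK
    have : IsFiniteMeasure (volume.restrict K) := ⟨by simpa using hK.measure_lt_top⟩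
    obtain ⟨C, hC⟩ := hK.exists_bound_of_continuousOn (hf.mono hKU)
    exact MemLp.of_bound ((hf.mono hKU).aestronglyMeasurable hK.measurableSet) C
      (ae_restrict_of_forall_mem hK.measurableSet hC)
  refine ⟨fun e he K hK hKc => hmem (hsm e he).continuousOn hK hKc,
    fun e he K hK hKc v => hmem (hcont e he v) hK hKc, fun e he χ hχ hχc hχe v => ?_⟩
  have hz : ∀ p, p ∉ tsupport χ → χ p = 0 := fun p hp => image_eq_zero_of_notMem_tsupport hp
  -- Outside the chart target the two derivatives are unrelated, but there χ vanishes.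
  have hcongr : ∀ p, differential φ (e.symm p) (chartVector e p v) * χ p
      = fderiv ℝ (φ ∘ e.symm) p v * χ p := fun p => by
    by_cases hp : p ∈ tsupport χ
    · rw [hder e he p (hχe hp) v]
    · rw [hz p hp, mul_zero, mul_zero]
  have i1 := integrable_mul_of_memLp (μ := volume) hχc (hmem (hsm e he).continuousOn hχe hχc)
    (continuous_fderiv_apply hχ v) (fun p hp => fderiv_apply_eq_zero_of_notMem_tsupport hp v)
  have i2 := integrable_mul_of_memLp (μ := volume) hχc (hmem (hsm e he).continuousOn hχe hχc)
    hχ.continuous hz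
  have i3 := integrable_mul_of_memLp (μ := volume) hχc (hmem (hcont e he v) hχe hχc)
    hχ.continuous hz
  simp only [hcongr] at i3 ⊢
  exact integral_mul_fderiv_eq_neg_fderiv_mul_of_integrable i3 i1 i2
    (fun p hp => ((hsm e he).differentiableOn (by simp)).differentiableAt
      (e.open_target.mem_nhds (hχe hp)))
    (fun p _ => hχ.differentiable (by simp) p)

variable [MeasurableSpace M] [BorelSpace M] [SecondCountableTopology M] [Nonempty M]

theorem HasWeakDifferential.aemeasurable_hausdorffVolume (hu : HasWeakDifferential u θ)
    (F : TangentBundle (𝓡 n) M → ℝ) : AEMeasurable u (hausdorffVolume F) := by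
  refine aemeasurable_of_charts (n := n) (f := u) (G := F) fun e he => ?_
  obtain ⟨K, hK, hKu⟩ := exists_isCompact_iUnion_eq e.open_target
  have h1 : ∀ i, AEMeasurable (fun p => u (e.symm p)) (volume.restrict (K i)) := fun i =>
    (hu.memLp e he (K i) (hKu ▸ subset_iUnion K i) (hK i)).1.aemeasurable
  rw [← hKu]
  exact aemeasurable_iUnion_iff.2 h1

theorem HasWeakDifferential.congr (hF : IsGauge F) (hu : HasWeakDifferential u θ)
    (huw : u =ᵐ[hausdorffVolume F] w) : HasWeakDifferential w θ := by
  have hae : ∀ e ∈ atlas (EuclideanSpace ℝ (Fin n)) M,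
      ∀ᵐ p ∂volume.restrict e.target, u (e.symm p) = w (e.symm p) :=
    fun e he => ae_target_of_ae hF he huw
  refine ⟨fun e he K hK hKc => ?_, hu.memLp_differential, fun e he φ hφ hφc hφe v => ?_⟩
  · exact MemLp.ae_eq (ae_mono (Measure.restrict_mono hK le_rfl) (hae e he))
      (hu.memLp e he K hK hKc)
  · rw [← hu.integral_eq e he φ hφ hφc hφe v]
    refine integral_congr_ae ?_
    filter_upwards [(ae_restrict_iff' e.open_target.measurableSet).1 (hae e he)] with p hp
    by_cases hpφ : p ∈ tsupport φ
    · rw [hp (hφe hpφ)]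
    · rw [fderiv_apply_eq_zero_of_notMem_tsupport hpφ, mul_zero, mul_zero]

/-- The weak differential is unique up to null sets. -/
theorem HasWeakDifferential.unique (hu : HasWeakDifferential u θ) (hu' : HasWeakDifferential u η) :
    ∀ᵐ x ∂hausdorffVolume F, θ x = η x := by
  -- The difference of the two covector fields is a weak differential of zero, so the fundamental
  -- lemma of the calculus of variations kills its components in each chart.
  have hw := hu.add (hu'.smul (-1))
  refine ae_of_ae_charts fun e he => ?_
  have hzero : ∀ v, ∀ᵐ p ∂volume.restrict e.target,
      (θ (e.symm p) + (-1 : ℝ) • η (e.symm p)) (chartVector e p v) = 0 := by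
    intro v
    rw [ae_restrict_iff' e.open_target.measurableSet]
    refine e.open_target.ae_eq_zero_of_integral_contDiff_smul_eq_zero ?_ fun g hg hgc hge => ?_
    · refine (locallyIntegrableOn_iff e.open_target.isLocallyClosed).2 fun K hK hKc => ?_
      have : IsFiniteMeasure (volume.restrict K) := ⟨by simpa using hKc.measure_lt_top⟩
      exact (hw.memLp_differential e he K hK hKc v).integrable one_le_two
    · have h := hw.integral_eq e he g hg hgc hge v
      have h0 : ∀ p : EuclideanSpace ℝ (Fin n), u (e.symm p) + -1 * u (e.symm p) = 0 := fun p => by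
        ring
      simp only [h0, zero_mul, integral_zero] at h
      rw [eq_comm, neg_eq_zero] at h
      rw [← h]
      exact integral_congr_ae (Eventually.of_forall fun p => by simp only [smul_eq_mul, mul_comm])
  have hall : ∀ᵐ p ∂volume.restrict e.target, ∀ l : Fin n,
      (θ (e.symm p) + (-1 : ℝ) • η (e.symm p)) (chartVector e p (EuclideanSpace.single l 1)) = 0 :=
    ae_all_iff.2 fun l => hzero _
  filter_upwards [hall, ae_restrict_mem e.open_target.measurableSet] with p hp hpt
  ext y
  obtain ⟨v, rfl⟩ := (chartVector_bijective he hpt).2 y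
  let L : EuclideanSpace ℝ (Fin n) →L[ℝ] ℝ :=
    ContinuousLinearMap.comp (θ (e.symm p) + (-1 : ℝ) • η (e.symm p) :
      EuclideanSpace ℝ (Fin n) →L[ℝ] ℝ)
      (mfderiv 𝓘(ℝ, EuclideanSpace ℝ (Fin n)) (𝓡 n) e.symm p :
        EuclideanSpace ℝ (Fin n) →L[ℝ] EuclideanSpace ℝ (Fin n))
  have hL : L = 0 := by
    refine ContinuousLinearMap.coe_injective
      ((EuclideanSpace.basisFun (Fin n) ℝ).toBasis.ext fun l => ?_)
    rw [OrthonormalBasis.coe_toBasis, EuclideanSpace.basisFun_apply]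
    exact hp l
  have h1 : L v = 0 := by rw [hL]; rfl
  have h2 : L v = θ (e.symm p) (chartVector e p v) - η (e.symm p) (chartVector e p v) := by
    change θ (e.symm p) (chartVector e p v) + (-1 : ℝ) * η (e.symm p) (chartVector e p v) = _
    ring
  exact sub_eq_zero.1 (h2.symm.trans h1)

theorem exists_eLpNorm_chart_le (hF : IsGauge F) (he : e ∈ atlas (EuclideanSpace ℝ (Fin n)) M)
    {K : Set (EuclideanSpace ℝ (Fin n))} (hK : IsCompact K) (hKe : K ⊆ e.target) :
    ∃ C : ℝ≥0∞, C ≠ ⊤ ∧ ∀ f : M → ℝ, AEMeasurable f (hausdorffVolume F) →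
      eLpNorm (fun p => f (e.symm p)) 2 (volume.restrict K)
        ≤ C * eLpNorm f 2 (hausdorffVolume F) := by
  obtain ⟨C, hC, hle⟩ := exists_map_volume_restrict_le hF he hK hKe
  refine ⟨C ^ (1 / (2 : ℝ≥0∞)).toReal, ENNReal.rpow_ne_top_of_nonneg (by simp) hC, fun f hf => ?_⟩
  have hac : Measure.map e.symm (volume.restrict K) ≪ hausdorffVolume F :=
    (Measure.absolutelyContinuous_of_le hle).trans Measure.smul_absolutelyContinuous
  have h1 : eLpNorm (fun p => f (e.symm p)) 2 (volume.restrict K)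
      = eLpNorm f 2 (Measure.map e.symm (volume.restrict K)) :=
    (eLpNorm_map_measure (hf.mono_ac hac).aestronglyMeasurable
      ((aemeasurable_symm e).mono_measure (Measure.restrict_mono hKe le_rfl))).symm
  rw [h1, ← smul_eq_mul, ← eLpNorm_smul_measure_of_ne_top (by simp)]
  exact eLpNorm_mono_measure f hle

/-- Symmetry of G turns the one-sided polar inequality into a bound on |θ(v)|; on the compact set K
the G-length of v is at most b ‖v‖. -/
theorem exists_eLpNorm_covector_chart_le (hF : IsGauge F) (hG : IsGauge G)
    (hsymm : ∀ (x : M) (y : TangentSpace (𝓡 n) x), G ⟨x, -y⟩ = G ⟨x, y⟩)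
    (he : e ∈ atlas (EuclideanSpace ℝ (Fin n)) M)
    {K : Set (EuclideanSpace ℝ (Fin n))} (hK : IsCompact K) (hKe : K ⊆ e.target)
    (v : EuclideanSpace ℝ (Fin n)) :
    ∃ C : ℝ≥0∞, C ≠ ⊤ ∧ ∀ θ : (x : M) → TangentSpace (𝓡 n) x →L[ℝ] ℝ, AEMeasurableCovector θ →
      eLpNorm (fun p => θ (e.symm p) (chartVector e p v)) 2 (volume.restrict K)
        ≤ C * eLpNorm (fun x => polar G x (θ x)) 2 (hausdorffVolume F) := by
  obtain ⟨C, hC, h⟩ := exists_eLpNorm_chart_le hF he hK hKe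
  obtain ⟨a, b, ha, hb, hab⟩ := exists_chartMetric_bounds hG he hK hKe
  refine ⟨ENNReal.ofReal (b * ‖v‖) * C, ENNReal.mul_ne_top ENNReal.ofReal_ne_top hC,
    fun θ hθ => ?_⟩
  rw [mul_assoc]
  refine le_trans ?_ (mul_le_mul_right (h _ (hθ.polar hG)) _)
  refine eLpNorm_le_mul_eLpNorm_of_ae_le_mul
    (ae_restrict_of_forall_mem hK.measurableSet fun p hp => ?_) 2
  rw [Real.norm_eq_abs, Real.norm_of_nonneg (hG.polar_nonneg _ _)]
  calc |θ (e.symm p) (chartVector e p v)|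
      ≤ polar G (e.symm p) (θ (e.symm p)) * chartMetric G e p v :=
        hG.abs_le_polar_mul (hsymm _) _ _
    _ ≤ polar G (e.symm p) (θ (e.symm p)) * (b * ‖v‖) :=
        mul_le_mul_of_nonneg_left (hab p hp v).2 (hG.polar_nonneg _ _)
    _ = b * ‖v‖ * polar G (e.symm p) (θ (e.symm p)) := mul_comm _ _

/-- Weak differentials are closed under `L²` convergence. -/
theorem HasWeakDifferential.of_tendsto (hF : IsGauge F) (hG : IsGauge G)
    (hsymm : ∀ (x : M) (y : TangentSpace (𝓡 n) x), G ⟨x, -y⟩ = G ⟨x, y⟩)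
    {uk : ℕ → M → ℝ} {θk : ℕ → (x : M) → TangentSpace (𝓡 n) x →L[ℝ] ℝ}
    (h : ∀ k, HasWeakDifferential (uk k) (θk k)) (hu : AEMeasurable u (hausdorffVolume F))
    (hθ : AEMeasurableCovector θ)
    (hlim : Tendsto (fun k => eLpNorm (fun x => uk k x - u x) 2 (hausdorffVolume F)) atTop (𝓝 0))
    (hlim' : Tendsto (fun k => eLpNorm (fun x => polar G x (θk k x - θ x)) 2 (hausdorffVolume F))
      atTop (𝓝 0)) : HasWeakDifferential u θ := by
  have hsub : ∀ k, AEMeasurableCovector (fun x => θk k x - θ x) := fun k => by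
    have h1 : (fun x => θk k x - θ x) = fun x => θk k x + (-1 : ℝ) • θ x := by
      ext x y
      change θk k x y - θ x y = θk k x y + -1 * θ x y
      ring
    rw [h1]
    exact (h k).aemeasurableCovector.add (hθ.smul (-1))
  have hconv : ∀ e ∈ atlas (EuclideanSpace ℝ (Fin n)) M, ∀ K ⊆ e.target, IsCompact K →
      Tendsto (fun k => eLpNorm ((fun p => uk k (e.symm p)) - fun p => u (e.symm p)) 2
        (volume.restrict K)) atTop (𝓝 0) := by
    intro e he K hK hKc
    obtain ⟨C, hC, hle⟩ := exists_eLpNorm_chart_le hF he hKc hK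
    refine tendsto_of_tendsto_of_tendsto_of_le_of_le tendsto_const_nhds
      (by simpa using ENNReal.Tendsto.const_mul hlim (Or.inr hC)) (fun k => zero_le)
      fun k => ?_
    exact hle (fun x => uk k x - u x) (((h k).aemeasurable_hausdorffVolume F).sub hu)
  have hconv' : ∀ e ∈ atlas (EuclideanSpace ℝ (Fin n)) M, ∀ K ⊆ e.target, IsCompact K → ∀ v,
      Tendsto (fun k => eLpNorm ((fun p => θk k (e.symm p) (chartVector e p v)) -
        fun p => θ (e.symm p) (chartVector e p v)) 2 (volume.restrict K)) atTop (𝓝 0) := by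
    intro e he K hK hKc v
    obtain ⟨C, hC, hle⟩ := exists_eLpNorm_covector_chart_le hF hG hsymm he hKc hK v
    refine tendsto_of_tendsto_of_tendsto_of_le_of_le tendsto_const_nhds
      (by simpa using ENNReal.Tendsto.const_mul hlim' (Or.inr hC)) (fun k => zero_le)
      fun k => ?_
    exact hle (fun x => θk k x - θ x) (hsub k)
  -- The limit f is fk - (fk - f) for an index k at which the difference has L² norm below 1.
  have hmem : ∀ {μ : Measure (EuclideanSpace ℝ (Fin n))} {fk : ℕ → EuclideanSpace ℝ (Fin n) → ℝ}
      {f : EuclideanSpace ℝ (Fin n) → ℝ}, (∀ k, MemLp (fk k) 2 μ) → AEMeasurable f μ →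
      Tendsto (fun k => eLpNorm (fk k - f) 2 μ) atTop (𝓝 0) → MemLp f 2 μ := by
    intro μ fk f hfk hf ht
    obtain ⟨k, hk⟩ := (ht.eventually (gt_mem_nhds zero_lt_one)).exists
    have h1 : MemLp (fk k - f) 2 μ :=
      ⟨((hfk k).1.aemeasurable.sub hf).aestronglyMeasurable, hk.trans ENNReal.one_lt_top⟩
    have := (hfk k).sub h1
    rwa [sub_sub_cancel] at this
  have hu2 : ∀ e ∈ atlas (EuclideanSpace ℝ (Fin n)) M, ∀ K ⊆ e.target, IsCompact K →
      MemLp (fun p => u (e.symm p)) 2 (volume.restrict K) := fun e he K hK hKc =>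
    hmem (fun k => (h k).memLp e he K hK hKc)
      ((aemeasurable_chart hF he hu).mono_measure (Measure.restrict_mono hK le_rfl))
      (hconv e he K hK hKc)
  have hθ2 : ∀ e ∈ atlas (EuclideanSpace ℝ (Fin n)) M, ∀ K ⊆ e.target, IsCompact K → ∀ v,
      MemLp (fun p => θ (e.symm p) (chartVector e p v)) 2 (volume.restrict K) :=
    fun e he K hK hKc v =>
    hmem (fun k => (h k).memLp_differential e he K hK hKc v)
      ((hθ e he v).mono_measure (Measure.restrict_mono hK le_rfl))
      (hconv' e he K hK hKc v)
  refine ⟨hu2, hθ2, fun e he φ hφ hφc hφe v => ?_⟩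
  have l1 := tendsto_integral_mul_of_memLp (μ := volume) hφc
    (fun k => (h k).memLp e he _ hφe hφc) (hu2 e he _ hφe hφc) (hconv e he _ hφe hφc)
    (continuous_fderiv_apply hφ v) (fun p hp => fderiv_apply_eq_zero_of_notMem_tsupport hp v)
  have l2 := tendsto_integral_mul_of_memLp (μ := volume) hφc
    (fun k => (h k).memLp_differential e he _ hφe hφc v) (hθ2 e he _ hφe hφc v)
    (hconv' e he _ hφe hφc v) hφ.continuous (fun p hp => image_eq_zero_of_notMem_tsupport hp)
  refine tendsto_nhds_unique l1 ?_
  simp only [fun k => (h k).integral_eq e he φ hφ hφc hφe v]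
  exact l2.neg

end WeakDifferential

/-! ### Sobolev norms -/

/-- Minkowski's inequality in the plane, with the sum in the first slot replaced by a nonnegative
lower quantity because the polar transform is only subadditive. -/
theorem sqrt_add_sq_le {a b c d s t : ℝ} (hs0 : 0 ≤ s) (hs : s ≤ a + b)
    (ht : |t| ≤ |c + d|) : √(s ^ 2 + t ^ 2) ≤ √(a ^ 2 + c ^ 2) + √(b ^ 2 + d ^ 2) := by
  have hP : 0 ≤ √(a ^ 2 + c ^ 2) := Real.sqrt_nonneg _
  have hQ : 0 ≤ √(b ^ 2 + d ^ 2) := Real.sqrt_nonneg _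
  have hP2 : √(a ^ 2 + c ^ 2) ^ 2 = a ^ 2 + c ^ 2 := Real.sq_sqrt (by positivity)
  have hQ2 : √(b ^ 2 + d ^ 2) ^ 2 = b ^ 2 + d ^ 2 := Real.sq_sqrt (by positivity)
  have hcs : a * b + c * d ≤ √(a ^ 2 + c ^ 2) * √(b ^ 2 + d ^ 2) := by
    refine le_of_abs_le (abs_le_of_sq_le_sq ?_ (by positivity))
    rw [mul_pow, hP2, hQ2]
    nlinarith [sq_nonneg (a * d - b * c)]
  have hs2 : s ^ 2 ≤ (a + b) ^ 2 := pow_le_pow_left₀ hs0 hs 2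
  have ht2 : t ^ 2 ≤ (c + d) ^ 2 := sq_le_sq.2 ht
  refine Real.sqrt_le_iff.2 ⟨by positivity, ?_⟩
  nlinarith

section Sobolev

variable [IsManifold (𝓡 n) ∞ M] {F G G' : TangentBundle (𝓡 n) M → ℝ} {u w : M → ℝ}
  {θ η : (x : M) → TangentSpace (𝓡 n) x →L[ℝ] ℝ}

/-- The pointwise norm of a function together with a covector field. -/
def jetNorm (G : TangentBundle (𝓡 n) M → ℝ) (u : M → ℝ)
    (θ : (x : M) → TangentSpace (𝓡 n) x →L[ℝ] ℝ) (x : M) : ℝ :=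
  √(polar G x (θ x) ^ 2 + u x ^ 2)

omit [IsManifold (𝓡 n) ∞ M] in
theorem jetNorm_nonneg (x : M) : 0 ≤ jetNorm G u θ x := Real.sqrt_nonneg _

omit [IsManifold (𝓡 n) ∞ M] in
theorem abs_le_jetNorm (x : M) : |u x| ≤ jetNorm G u θ x :=
  Real.abs_le_sqrt (by nlinarith [sq_nonneg (polar G x (θ x))])

theorem jetNorm_add_le (hG : IsGauge G) (x : M) :
    jetNorm G (fun x => u x + w x) (fun x => θ x + η x) x
      ≤ jetNorm G u θ x + jetNorm G w η x :=
  sqrt_add_sq_le (hG.polar_nonneg _ _) (hG.polar_add_le _ _ _) le_rfl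

theorem jetNorm_le_mul (hG : IsGauge G) {x : M} {k : ℝ} (hk : 0 ≤ k)
    (hθ : polar G x (θ x) ≤ k * polar G' x (η x)) (hu : |u x| ≤ k * |w x|) :
    jetNorm G u θ x ≤ k * jetNorm G' w η x := by
  rw [jetNorm, jetNorm, ← Real.sqrt_sq hk, ← Real.sqrt_mul (sq_nonneg k)]
  refine Real.sqrt_le_sqrt ?_
  have h1 : polar G x (θ x) ^ 2 ≤ (k * polar G' x (η x)) ^ 2 :=
    pow_le_pow_left₀ (hG.polar_nonneg _ _) hθ 2
  have h2 : |u x| ^ 2 ≤ (k * |w x|) ^ 2 := pow_le_pow_left₀ (abs_nonneg _) hu 2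
  rw [mul_pow, sq_abs, sq_abs] at h2
  nlinarith

theorem MemW12loc.hasWeakDifferential (hu : MemW12loc (n := n) u) :
    HasWeakDifferential u (weakDifferential (n := n) u) := by
  rw [weakDifferential, dif_pos hu]
  exact hu.choose_spec

variable [MeasurableSpace M] [BorelSpace M] [SecondCountableTopology M] [Nonempty M]

/-- The weak differential is picked by choice, so it can be identified with a given representative
only almost everywhere. -/
theorem HasWeakDifferential.weakDifferential_ae (hF : IsGauge F) (hu : HasWeakDifferential u θ)
    (huw : u =ᵐ[hausdorffVolume F] w) :
    ∀ᵐ x ∂hausdorffVolume F, weakDifferential (n := n) w x = θ x :=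
  (MemW12loc.hasWeakDifferential ⟨θ, hu.congr hF huw⟩).unique (hu.congr hF huw)

theorem HasWeakDifferential.aemeasurable_jetNorm (hG : IsGauge G) (hu : HasWeakDifferential u θ)
    (F : TangentBundle (𝓡 n) M → ℝ) :
    AEMeasurable (jetNorm G u θ) (hausdorffVolume F) :=
  ((((hu.aemeasurableCovector.polar hG).pow_const 2).add
    ((hu.aemeasurable_hausdorffVolume F).pow_const 2)).sqrt)

theorem HasWeakDifferential.energy_eq (hF : IsGauge F) (hu : HasWeakDifferential u θ)
    (huw : u =ᵐ[hausdorffVolume F] w) : energy G (hausdorffVolume F) w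
      = ∫⁻ x, ENNReal.ofReal (polar G x (θ x) ^ 2) ∂hausdorffVolume F :=
  lintegral_congr_ae ((hu.weakDifferential_ae hF huw).mono fun x hx => by simp only [hx])

/-- Any representatives of u and of its differential may be used, and the Sobolev norm becomes a
scalar L² norm, so that its properties follow from pointwise ones of `jetNorm`. -/
theorem HasWeakDifferential.sobolevENorm_eq (hF : IsGauge F) (hG : IsGauge G)
    (hu : HasWeakDifferential u θ) (huw : u =ᵐ[hausdorffVolume F] w) :
    sobolevENorm G (hausdorffVolume F) w = eLpNorm (jetNorm G u θ) 2 (hausdorffVolume F) := by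
  rw [sobolevENorm, hu.energy_eq hF huw, eLpNorm_eq_lintegral_rpow_enorm_toReal (by simp) (by simp)]
  have h1 : ∫⁻ x, ENNReal.ofReal (w x ^ 2) ∂hausdorffVolume F
      = ∫⁻ x, ENNReal.ofReal (u x ^ 2) ∂hausdorffVolume F :=
    lintegral_congr_ae (huw.mono fun x hx => by simp only [hx])
  rw [h1, ← lintegral_add_left'
    ((hu.aemeasurableCovector.polar hG).pow_const 2).ennreal_ofReal]
  simp only [ENNReal.toReal_ofNat]
  congr 1
  refine lintegral_congr fun x => ?_
  rw [← ENNReal.ofReal_add (sq_nonneg _) (sq_nonneg _), Real.enorm_of_nonneg (jetNorm_nonneg x),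
    ENNReal.ofReal_rpow_of_nonneg (jetNorm_nonneg x) (by norm_num), Real.rpow_two, jetNorm,
    Real.sq_sqrt (by positivity)]

theorem HasWeakDifferential.sobolevENorm_eq_self (hF : IsGauge F) (hG : IsGauge G)
    (hu : HasWeakDifferential u θ) :
    sobolevENorm G (hausdorffVolume F) u = eLpNorm (jetNorm G u θ) 2 (hausdorffVolume F) :=
  hu.sobolevENorm_eq hF hG EventuallyEq.rfl

theorem HasWeakDifferential.sobolevENorm_congr (hF : IsGauge F) (hG : IsGauge G)
    (hu : HasWeakDifferential u θ) (huw : u =ᵐ[hausdorffVolume F] w) :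
    sobolevENorm G (hausdorffVolume F) w = sobolevENorm G (hausdorffVolume F) u := by
  rw [hu.sobolevENorm_eq hF hG huw, hu.sobolevENorm_eq_self hF hG]

theorem HasWeakDifferential.sobolevENorm_add_le (hF : IsGauge F) (hG : IsGauge G)
    (hu : HasWeakDifferential u θ) (hw : HasWeakDifferential w η) :
    sobolevENorm G (hausdorffVolume F) (fun x => u x + w x)
      ≤ sobolevENorm G (hausdorffVolume F) u + sobolevENorm G (hausdorffVolume F) w := by
  rw [(hu.add hw).sobolevENorm_eq_self hF hG, hu.sobolevENorm_eq_self hF hG,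
    hw.sobolevENorm_eq_self hF hG]
  refine (eLpNorm_mono_real fun x => ?_).trans (eLpNorm_add_le
    (hu.aemeasurable_jetNorm hG F).aestronglyMeasurable
    (hw.aemeasurable_jetNorm hG F).aestronglyMeasurable one_le_two)
  rw [Real.norm_of_nonneg (jetNorm_nonneg x)]
  exact jetNorm_add_le hG x

theorem HasWeakDifferential.sobolevENorm_le_mul (hF : IsGauge F) (hG : IsGauge G)
    (hG' : IsGauge G') (hu : HasWeakDifferential u θ) (hw : HasWeakDifferential w η) {k : ℝ}
    (hk : 0 ≤ k) (hpolar : ∀ x, polar G x (θ x) ≤ k * polar G' x (η x))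
    (habs : ∀ x, |u x| ≤ k * |w x|) :
    sobolevENorm G (hausdorffVolume F) u
      ≤ ENNReal.ofReal k * sobolevENorm G' (hausdorffVolume F) w := by
  rw [hu.sobolevENorm_eq_self hF hG, hw.sobolevENorm_eq_self hF hG']
  refine eLpNorm_le_mul_eLpNorm_of_ae_le_mul (Eventually.of_forall fun x => ?_) 2
  rw [Real.norm_of_nonneg (jetNorm_nonneg x), Real.norm_of_nonneg (jetNorm_nonneg x)]
  exact jetNorm_le_mul hG hk (hpolar x) (habs x)

/-- Multiplication by an arbitrary real number, for a gauge with reversibility at most `k`. -/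
theorem HasWeakDifferential.sobolevENorm_mul_le (hF : IsGauge F) (hG : IsGauge G) {k : ℝ}
    (hk : 1 ≤ k) (hrev : ∀ (x : M) (y : TangentSpace (𝓡 n) x), G ⟨x, -y⟩ ≤ k * G ⟨x, y⟩)
    (hu : HasWeakDifferential u θ) (c : ℝ) :
    sobolevENorm G (hausdorffVolume F) (fun x => c * u x)
      ≤ ENNReal.ofReal (|c| * k) * sobolevENorm G (hausdorffVolume F) u := by
  have hk0 : 0 ≤ k := zero_le_one.trans hk
  refine (hu.smul c).sobolevENorm_le_mul hF hG hG hu (by positivity) (fun x => ?_) fun x => ?_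
  · rcases le_or_gt 0 c with hc | hc
    · rw [hG.polar_smul x _ hc, abs_of_nonneg hc]
      have := hG.polar_nonneg x (θ x)
      nlinarith [mul_nonneg hc this]
    · have h1 : c • θ x = -((-c) • θ x) := by
        ext y
        change c * θ x y = -(-c * θ x y)
        ring
      rw [h1, abs_of_neg hc]
      refine (hG.polar_neg_le hk0 (hrev x) _).trans_eq ?_
      rw [hG.polar_smul x _ (by linarith)]
      ring
  · rw [abs_mul]
    nlinarith [mul_nonneg (abs_nonneg c) (abs_nonneg (u x))]

theorem HasWeakDifferential.sobolevENorm_mul_of_nonneg (hF : IsGauge F) (hG : IsGauge G)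
    (hu : HasWeakDifferential u θ) {c : ℝ} (hc : 0 ≤ c) :
    sobolevENorm G (hausdorffVolume F) (fun x => c * u x)
      = ENNReal.ofReal c * sobolevENorm G (hausdorffVolume F) u := by
  rw [(hu.smul c).sobolevENorm_eq_self hF hG, hu.sobolevENorm_eq_self hF hG]
  have h1 : jetNorm G (fun x => c * u x) (fun x => c • θ x) = c • jetNorm G u θ := by
    ext x
    simp only [jetNorm, Pi.smul_apply, smul_eq_mul]
    rw [hG.polar_smul x _ hc, ← Real.sqrt_sq hc, ← Real.sqrt_mul (sq_nonneg c), Real.sqrt_sq hc]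
    congr 1; ring
  rw [h1, eLpNorm_const_smul, Real.enorm_of_nonneg hc]

theorem HasWeakDifferential.eLpNorm_le_sobolevENorm (hF : IsGauge F) (hG : IsGauge G)
    (hu : HasWeakDifferential u θ) :
    eLpNorm u 2 (hausdorffVolume F) ≤ sobolevENorm G (hausdorffVolume F) u := by
  rw [hu.sobolevENorm_eq_self hF hG]
  exact eLpNorm_mono_real fun x => abs_le_jetNorm x

omit [BorelSpace M] [SecondCountableTopology M] [Nonempty M] in
theorem energy_le_sobolevENorm_sq {m : Measure M} :
    energy G m u ≤ sobolevENorm G m u ^ (2 : ℝ) := by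
  rw [sobolevENorm, ← ENNReal.rpow_mul]
  norm_num

/-! ### The Sobolev space `W₀^{1,2}` as a vector space -/

omit [BorelSpace M] [SecondCountableTopology M] [Nonempty M] in
theorem hasWeakDifferential_coeFn {u : M →ₘ[hausdorffVolume F] ℝ}
    (hu : u ∈ W12Zero F (hausdorffVolume F)) :
    HasWeakDifferential u (weakDifferential (n := n) u) :=
  MemW12loc.hasWeakDifferential hu.1.1

/-- Membership in W^{1,2} bounds only the energy. Square integrability of u comes from the
approximation: u = φ - (φ - u), with φ continuous of compact support and the measure locally finite.
-/
theorem sobolevENorm_lt_top (hF : IsGauge F) {u : M →ₘ[hausdorffVolume F] ℝ}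
    (hu : u ∈ W12Zero F (hausdorffVolume F)) : sobolevENorm F (hausdorffVolume F) u < ⊤ := by
  have : IsLocallyFiniteMeasure (hausdorffVolume F) := isLocallyFiniteMeasure_hausdorffVolume hF
  have hd := hasWeakDifferential_coeFn hu
  obtain ⟨φ, hφ, hφc, hlt⟩ := hu.2 1 one_pos
  have hφ2 : MemLp φ 2 (hausdorffVolume F) := hφ.continuous.memLp_of_hasCompactSupport hφc
  have hsub : MemLp (fun x => φ x - u x) 2 (hausdorffVolume F) := by
    have h1 := (hasWeakDifferential_of_contMDiff hφ).add (hd.smul (-1))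
    simp only [neg_one_mul, ← sub_eq_add_neg] at h1
    exact ⟨(h1.aemeasurable_hausdorffVolume F).aestronglyMeasurable,
      (h1.eLpNorm_le_sobolevENorm hF hF).trans_lt (hlt.trans ENNReal.one_lt_top)⟩
  have hu2 : MemLp u 2 (hausdorffVolume F) := by
    have := hφ2.sub hsub
    refine (memLp_congr_ae (Eventually.of_forall fun x => ?_)).1 this
    simp
  rw [sobolevENorm]
  refine ENNReal.rpow_lt_top_of_nonneg (by norm_num) (ENNReal.add_lt_top.2 ⟨hu.1.2, ?_⟩).ne
  have := hu2.integrable_sq.lintegral_lt_top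
  simpa using this

/-- A criterion for membership in `W₀^{1,2}`. -/
theorem mem_W12Zero_of_ae_eq (hF : IsGauge F) {u : M →ₘ[hausdorffVolume F] ℝ}
    (hw : HasWeakDifferential w η) (huw : w =ᵐ[hausdorffVolume F] u)
    (hfin : sobolevENorm F (hausdorffVolume F) w < ⊤)
    (happrox : ∀ ε : ℝ≥0∞, 0 < ε → ∃ φ : M → ℝ, ContMDiff (𝓡 n) 𝓘(ℝ, ℝ) ∞ φ ∧
      HasCompactSupport φ ∧ sobolevENorm F (hausdorffVolume F) (fun x => φ x - w x) < ε) :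
    u ∈ W12Zero F (hausdorffVolume F) := by
  refine ⟨⟨⟨η, hw.congr hF huw⟩, ?_⟩, fun ε hε => ?_⟩
  · rw [← hw.sobolevENorm_congr hF hF huw] at hfin
    exact energy_le_sobolevENorm_sq.trans_lt (ENNReal.rpow_lt_top_of_nonneg (by norm_num) hfin.ne)
  · obtain ⟨φ, hφ, hφc, hlt⟩ := happrox ε hε
    refine ⟨φ, hφ, hφc, ?_⟩
    have h1 := (hasWeakDifferential_of_contMDiff hφ).add (hw.smul (-1))
    simp only [neg_one_mul, ← sub_eq_add_neg] at h1
    rwa [h1.sobolevENorm_congr hF hF (huw.mono fun x hx => by simp only [hx])]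

omit [BorelSpace M] [SecondCountableTopology M] [Nonempty M] in
theorem hasWeakDifferential_sub_coeFn {u : M →ₘ[hausdorffVolume F] ℝ}
    (hu : u ∈ W12Zero F (hausdorffVolume F)) {φ : M → ℝ} (hφ : ContMDiff (𝓡 n) 𝓘(ℝ, ℝ) ∞ φ) :
    HasWeakDifferential (fun x => φ x - u x)
      (fun x => differential (n := n) φ x + (-1 : ℝ) • weakDifferential (n := n) u x) := by
  have h1 := (hasWeakDifferential_of_contMDiff hφ).add ((hasWeakDifferential_coeFn hu).smul (-1))
  simpa only [neg_one_mul, ← sub_eq_add_neg] using h1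

/-- `W₀^{1,2}(M, F, m)` as a vector space, for a gauge with finite reversibility. -/
def W12ZeroSubmodule (hF : IsGauge F) {k : ℝ} (hk : 1 ≤ k)
    (hrev : ∀ (x : M) (y : TangentSpace (𝓡 n) x), F ⟨x, -y⟩ ≤ k * F ⟨x, y⟩) :
    Submodule ℝ (M →ₘ[hausdorffVolume F] ℝ) where
  carrier := W12Zero F (hausdorffVolume F)
  zero_mem' := by
    have h0 : sobolevENorm F (hausdorffVolume F) (fun _ : M => (0 : ℝ)) = 0 := by
      rw [hasWeakDifferential_zero.sobolevENorm_eq_self hF hF]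
      have : jetNorm F (fun _ => 0) (fun _ => 0) = fun _ : M => (0 : ℝ) := by
        ext x; simp [jetNorm, hF.polar_zero]
      rw [this]; simp
    refine mem_W12Zero_of_ae_eq hF hasWeakDifferential_zero AEEqFun.coeFn_zero.symm
      (by simp [h0]) fun ε hε => ⟨fun _ => 0, contMDiff_const, HasCompactSupport.zero, ?_⟩
    simpa [h0] using hε
  add_mem' := by
    intro u w hu hw
    have hdu := hasWeakDifferential_coeFn hu
    have hdw := hasWeakDifferential_coeFn hw
    refine mem_W12Zero_of_ae_eq hF (hdu.add hdw) (AEEqFun.coeFn_add u w).symm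
      ((hdu.sobolevENorm_add_le hF hF hdw).trans_lt (ENNReal.add_lt_top.2
        ⟨sobolevENorm_lt_top hF hu, sobolevENorm_lt_top hF hw⟩)) fun ε hε => ?_
    obtain ⟨φ, hφ, hφc, h1⟩ := hu.2 (ε / 2) (ENNReal.half_pos hε.ne')
    obtain ⟨ψ, hψ, hψc, h2⟩ := hw.2 (ε / 2) (ENNReal.half_pos hε.ne')
    refine ⟨fun x => φ x + ψ x, hφ.add hψ, hφc.add hψc, ?_⟩
    have h3 := (hasWeakDifferential_sub_coeFn hu hφ).sobolevENorm_add_le hF hF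
      (hasWeakDifferential_sub_coeFn hw hψ)
    have h4 : (fun x => φ x + ψ x - (u x + w x)) = fun x => φ x - u x + (ψ x - w x) := by
      ext x; ring
    rw [h4]
    exact h3.trans_lt ((ENNReal.add_lt_add h1 h2).trans_eq (ENNReal.add_halves ε))
  smul_mem' := by
    intro c u hu
    have hdu := hasWeakDifferential_coeFn hu
    refine mem_W12Zero_of_ae_eq hF (hdu.smul c) (AEEqFun.coeFn_smul c u).symm
      ((hdu.sobolevENorm_mul_le hF hF hk hrev c).trans_lt (ENNReal.mul_lt_top
        ENNReal.ofReal_lt_top (sobolevENorm_lt_top hF hu))) fun ε hε => ?_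
    -- Scaling by a negative c costs the reversibility factor k; a vanishing factor is separated to
    -- avoid dividing by zero.
    obtain ⟨δ, hδ, hδε⟩ : ∃ δ : ℝ≥0∞, 0 < δ ∧ ENNReal.ofReal (|c| * k) * δ ≤ ε := by
      by_cases h0 : ENNReal.ofReal (|c| * k) = 0
      · exact ⟨1, one_pos, by simp [h0]⟩
      · exact ⟨ε / ENNReal.ofReal (|c| * k), ENNReal.div_pos hε.ne' ENNReal.ofReal_ne_top,
          ENNReal.mul_div_le⟩
    obtain ⟨φ, hφ, hφc, h1⟩ := hu.2 δ hδ
    have h2 := (hasWeakDifferential_sub_coeFn hu hφ).sobolevENorm_mul_le hF hF hk hrev c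
    have h4 : (fun x => c * φ x - c * u x) = fun x => c * (φ x - u x) := by
      ext x; ring
    refine ⟨fun x => c * φ x, contMDiff_const.mul hφ, hφc.mul_left, ?_⟩
    rw [h4]
    by_cases h0 : ENNReal.ofReal (|c| * k) = 0
    · rw [h0, zero_mul] at h2
      exact h2.trans_lt hε
    · exact h2.trans_lt ((ENNReal.mul_lt_mul_right h0 ENNReal.ofReal_ne_top h1).trans_le hδε)

end Sobolev

/-! ### Jets in a frame: comparison with a Euclidean norm -/

section Jet

variable [IsManifold (𝓡 n) ∞ M] {F G : TangentBundle (𝓡 n) M → ℝ} {u w : M → ℝ}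
  {θ η : (x : M) → TangentSpace (𝓡 n) x →L[ℝ] ℝ} {Y : Fin n → (x : M) → TangentSpace (𝓡 n) x}

/-- The value of a function together with the components of a covector field in a frame. -/
def jet (Y : Fin n → (x : M) → TangentSpace (𝓡 n) x) (u : M → ℝ)
    (θ : (x : M) → TangentSpace (𝓡 n) x →L[ℝ] ℝ) (x : M) : EuclideanSpace ℝ (Option (Fin n)) :=
  WithLp.toLp 2 fun o => o.elim (u x) fun i => θ x (Y i x)

omit [IsManifold (𝓡 n) ∞ M] in
theorem jet_none (x : M) : jet Y u θ x none = u x := rfl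

omit [IsManifold (𝓡 n) ∞ M] in
theorem jet_some (x : M) (i : Fin n) : jet Y u θ x (some i) = θ x (Y i x) := rfl

omit [IsManifold (𝓡 n) ∞ M] in
theorem jet_add (x : M) : jet Y (fun x => u x + w x) (fun x => θ x + η x) x
    = jet Y u θ x + jet Y w η x := by
  ext o; cases o <;> rfl

omit [IsManifold (𝓡 n) ∞ M] in
theorem jet_smul (c : ℝ) (x : M) : jet Y (fun x => c * u x) (fun x => c • θ x) x
    = c • jet Y u θ x := by
  ext o; cases o <;> rfl

omit [IsManifold (𝓡 n) ∞ M] in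
theorem norm_jet_sq (x : M) :
    ‖jet Y u θ x‖ ^ 2 = u x ^ 2 + ∑ i, θ x (Y i x) ^ 2 := by
  rw [EuclideanSpace.norm_sq_eq, Fintype.sum_option]
  simp only [Real.norm_eq_abs, sq_abs, jet_none, jet_some]

/-- Since the frame has unit length and G is symmetric, each component of θ is at most the polar
norm; then 1 and n are both at most (n + 1)². -/
theorem norm_jet_le (hG : IsGauge G)
    (hsymm : ∀ (x : M) (y : TangentSpace (𝓡 n) x), G ⟨x, -y⟩ = G ⟨x, y⟩)
    (hY : ∀ i x, G ⟨x, Y i x⟩ = 1) (x : M) :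
    ‖jet Y u θ x‖ ≤ (n + 1) * jetNorm G u θ x := by
  refine le_of_sq_le_sq ?_ (mul_nonneg (by positivity) (jetNorm_nonneg x))
  rw [norm_jet_sq, mul_pow, jetNorm, Real.sq_sqrt (by positivity)]
  have h1 : ∀ i ∈ Finset.univ, θ x (Y i x) ^ 2 ≤ polar G x (θ x) ^ 2 := fun i _ => by
    have := hG.abs_le_polar_mul (hsymm x) (θ x) (Y i x)
    rw [hY, mul_one] at this
    rw [← sq_abs]
    exact pow_le_pow_left₀ (abs_nonneg _) this 2
  have h2 := Finset.sum_le_card_nsmul _ _ _ h1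
  simp only [Finset.card_univ, Fintype.card_fin, nsmul_eq_mul] at h2
  have hn : (0 : ℝ) ≤ n := by positivity
  nlinarith [mul_nonneg hn (sq_nonneg (u x)), mul_nonneg hn (sq_nonneg (polar G x (θ x))),
    mul_nonneg (mul_nonneg hn hn) (sq_nonneg (u x)), sq_nonneg (polar G x (θ x)),
    mul_nonneg (mul_nonneg hn hn) (sq_nonneg (polar G x (θ x)))]

/-- Each of the n terms in the expansion of y contributes at most 2 G(y) times the norm of the jet.
-/
theorem polar_le_norm_jet (hG : IsGauge G)
    (hc : ∀ x y, ∃ c : Fin n → ℝ, y = ∑ i, c i • Y i x ∧ ∀ i, |c i| ≤ 2 * G ⟨x, y⟩) (x : M) :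
    polar G x (θ x) ≤ 2 * n * ‖jet Y u θ x‖ := by
  refine hG.polar_le (by positivity) fun y => ?_
  obtain ⟨c, hy, hcb⟩ := hc x y
  have h1 : θ x y = ∑ i, c i * θ x (Y i x) := by
    conv_lhs => rw [hy, map_sum]
    simp
  have h2 : ∀ i ∈ Finset.univ, c i * θ x (Y i x) ≤ 2 * G ⟨x, y⟩ * ‖jet Y u θ x‖ := fun i _ => by
    refine (le_abs_self _).trans ?_
    rw [abs_mul]
    have h3 : |θ x (Y i x)| ≤ ‖jet Y u θ x‖ := by
      have := PiLp.norm_apply_le (jet Y u θ x) (some i)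
      rwa [jet_some, Real.norm_eq_abs] at this
    exact mul_le_mul (hcb i) h3 (abs_nonneg _) ((abs_nonneg _).trans (hcb i))
  have h4 := Finset.sum_le_card_nsmul _ _ _ h2
  simp only [Finset.card_univ, Fintype.card_fin, nsmul_eq_mul] at h4
  rw [h1]
  linarith

theorem jetNorm_le_norm_jet (hG : IsGauge G)
    (hc : ∀ x y, ∃ c : Fin n → ℝ, y = ∑ i, c i • Y i x ∧ ∀ i, |c i| ≤ 2 * G ⟨x, y⟩) (x : M) :
    jetNorm G u θ x ≤ (2 * n + 1) * ‖jet Y u θ x‖ := by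
  have h1 := polar_le_norm_jet (u := u) (θ := θ) hG hc x
  have h2 : |u x| ≤ ‖jet Y u θ x‖ := by
    have := PiLp.norm_apply_le (jet Y u θ x) none
    rwa [jet_none, Real.norm_eq_abs] at this
  refine Real.sqrt_le_iff.2 ⟨by positivity, ?_⟩
  have h3 := pow_le_pow_left₀ (hG.polar_nonneg x (θ x)) h1 2
  have h4 := pow_le_pow_left₀ (abs_nonneg (u x)) h2 2
  rw [sq_abs] at h4
  have hn : (0 : ℝ) ≤ n := by positivity
  nlinarith [mul_nonneg hn (sq_nonneg ‖jet Y u θ x‖)]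

omit [IsManifold (𝓡 n) ∞ M] in
-- A spanning family of n vectors in dimension n is a basis, so components can be prescribed. This
-- rebuilds a covector field from an L² limit of jets.
theorem exists_covector_of_frame
    (hspan : ∀ x (y : TangentSpace (𝓡 n) x), ∃ c : Fin n → ℝ, y = ∑ i, c i • Y i x) (x : M)
    (a : Fin n → ℝ) : ∃ α : TangentSpace (𝓡 n) x →L[ℝ] ℝ, ∀ i, α (Y i x) = a i := by
  let v : Fin n → EuclideanSpace ℝ (Fin n) := fun i => Y i x
  have htop : ⊤ ≤ Submodule.span ℝ (range v) := fun y _ => by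
    obtain ⟨c, hc⟩ := hspan x y
    have hc' : y = ∑ i, c i • v i := hc
    rw [hc']
    exact Submodule.sum_mem _ fun i _ =>
      Submodule.smul_mem _ _ (Submodule.subset_span (mem_range_self i))
  let B := basisOfTopLeSpanOfCardEqFinrank v htop (by simp)
  let α : EuclideanSpace ℝ (Fin n) →L[ℝ] ℝ := LinearMap.toContinuousLinearMap (B.constr ℝ a)
  refine ⟨α, fun i => ?_⟩
  have hB : B i = v i := by simp [B]
  change B.constr ℝ a (v i) = a i
  rw [← hB, Module.Basis.constr_basis]

variable [MeasurableSpace M] [BorelSpace M] [SecondCountableTopology M] [Nonempty M]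

theorem HasWeakDifferential.aemeasurable_jet (hu : HasWeakDifferential u θ)
    (hY : ∀ θ : (x : M) → TangentSpace (𝓡 n) x →L[ℝ] ℝ, AEMeasurableCovector θ →
      ∀ i, AEMeasurable (fun x => θ x (Y i x)) (hausdorffVolume F)) :
    AEMeasurable (jet Y u θ) (hausdorffVolume F) := by
  refine (PiLp.continuous_toLp 2 _).measurable.comp_aemeasurable (aemeasurable_pi_iff.2 fun o => ?_)
  cases o with
  | none => exact hu.aemeasurable_hausdorffVolume F
  | some i => exact hY θ hu.aemeasurableCovector i

theorem HasWeakDifferential.jet_ae_eq (hF : IsGauge F) (hu : HasWeakDifferential u θ)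
    (huw : u =ᵐ[hausdorffVolume F] w) :
    jet Y w (weakDifferential (n := n) w) =ᵐ[hausdorffVolume F] jet Y u θ := by
  filter_upwards [hu.weakDifferential_ae hF huw, huw] with x h1 h2
  simp only [jet, h1, h2]

end Jet

/-! ### Norm axioms on W₀^{1,2} -/

section Norm

variable [IsManifold (𝓡 n) ∞ M] [MeasurableSpace M] [BorelSpace M] [SecondCountableTopology M]
  [Nonempty M] {F G : TangentBundle (𝓡 n) M → ℝ} {u w : M →ₘ[hausdorffVolume F] ℝ}

theorem sobolevNorm_add_le (hF : IsGauge F) (hG : IsGauge G)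
    (hu : u ∈ W12Zero F (hausdorffVolume F)) (hw : w ∈ W12Zero F (hausdorffVolume F))
    (hu' : sobolevENorm G (hausdorffVolume F) u < ⊤)
    (hw' : sobolevENorm G (hausdorffVolume F) w < ⊤) :
    sobolevNorm G (hausdorffVolume F) (u + w : M →ₘ[hausdorffVolume F] ℝ)
      ≤ sobolevNorm G (hausdorffVolume F) u + sobolevNorm G (hausdorffVolume F) w := by
  have hdu := hasWeakDifferential_coeFn hu
  have hdw := hasWeakDifferential_coeFn hw
  rw [sobolevNorm, sobolevNorm, sobolevNorm, ← ENNReal.toReal_add hu'.ne hw'.ne,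
    (hdu.add hdw).sobolevENorm_congr hF hG (AEEqFun.coeFn_add u w).symm]
  exact ENNReal.toReal_mono (ENNReal.add_ne_top.2 ⟨hu'.ne, hw'.ne⟩)
    (hdu.sobolevENorm_add_le hF hG hdw)

theorem sobolevNorm_smul_of_nonneg (hF : IsGauge F) (hG : IsGauge G)
    (hu : u ∈ W12Zero F (hausdorffVolume F)) {c : ℝ} (hc : 0 ≤ c) :
    sobolevNorm G (hausdorffVolume F) (c • u : M →ₘ[hausdorffVolume F] ℝ)
      = c * sobolevNorm G (hausdorffVolume F) u := by
  have hdu := hasWeakDifferential_coeFn hu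
  rw [sobolevNorm, sobolevNorm, (hdu.smul c).sobolevENorm_congr hF hG (AEEqFun.coeFn_smul c u).symm,
    hdu.sobolevENorm_mul_of_nonneg hF hG hc, ENNReal.toReal_mul, ENNReal.toReal_ofReal hc]

theorem sobolevNorm_neg_of_symm (hF : IsGauge F) (hG : IsGauge G)
    (hsymm : ∀ (x : M) (y : TangentSpace (𝓡 n) x), G ⟨x, -y⟩ = G ⟨x, y⟩)
    (hu : u ∈ W12Zero F (hausdorffVolume F)) :
    sobolevNorm G (hausdorffVolume F) (-u : M →ₘ[hausdorffVolume F] ℝ)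
      = sobolevNorm G (hausdorffVolume F) u := by
  have hdu := hasWeakDifferential_coeFn hu
  have hrev : ∀ (x : M) (y : TangentSpace (𝓡 n) x), G ⟨x, -y⟩ ≤ 1 * G ⟨x, y⟩ := fun x y => by
    rw [hsymm, one_mul]
  have hae : (fun x => -1 * u x) =ᵐ[hausdorffVolume F] (-u : M →ₘ[hausdorffVolume F] ℝ) := by
    filter_upwards [AEEqFun.coeFn_neg u] with x hx
    rw [hx]; simp
  rw [sobolevNorm, sobolevNorm, (hdu.smul (-1)).sobolevENorm_congr hF hG hae]
  congr 1
  refine le_antisymm ?_ ?_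
  · simpa using hdu.sobolevENorm_mul_le hF hG le_rfl hrev (-1)
  · simpa using (hdu.smul (-1)).sobolevENorm_mul_le hF hG le_rfl hrev (-1)

/-- Definiteness is already forced by the L² term, elements being classes modulo null sets. -/
theorem sobolevNorm_eq_zero_iff (hF : IsGauge F) (hG : IsGauge G)
    (hu : u ∈ W12Zero F (hausdorffVolume F))
    (hu' : sobolevENorm G (hausdorffVolume F) u < ⊤) :
    sobolevNorm G (hausdorffVolume F) u = 0 ↔ u = 0 := by
  have hdu := hasWeakDifferential_coeFn hu
  constructor
  · intro h
    rw [sobolevNorm, ENNReal.toReal_eq_zero_iff, or_iff_left hu'.ne] at h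
    have h1 := hdu.eLpNorm_le_sobolevENorm hF hG
    rw [h, nonpos_iff_eq_zero, eLpNorm_eq_zero_iff u.aestronglyMeasurable (by simp)] at h1
    exact AEEqFun.ext (h1.trans AEEqFun.coeFn_zero.symm)
  · rintro rfl
    have h := sobolevNorm_smul_of_nonneg hF hG hu (c := 0) le_rfl
    rwa [zero_smul, zero_mul] at h

end Norm

/-! ### Completeness and reflexivity -/

section Reflexive

variable [IsManifold (𝓡 n) ∞ M] [MeasurableSpace M] [BorelSpace M] [SecondCountableTopology M]
  [Nonempty M] {F G : TangentBundle (𝓡 n) M → ℝ}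

/-- Polarity reverses the comparison of gauges; 1 ≤ k lets the same constant absorb the zeroth-order
term. -/
theorem sobolevENorm_le_of_gauge_le (hF : IsGauge F) {G G' : TangentBundle (𝓡 n) M → ℝ}
    (hG : IsGauge G) (hG' : IsGauge G') {k : ℝ} (hk : 1 ≤ k)
    (hle : ∀ (x : M) (y : TangentSpace (𝓡 n) x), G' ⟨x, y⟩ ≤ k * G ⟨x, y⟩) {u : M → ℝ}
    {θ : (x : M) → TangentSpace (𝓡 n) x →L[ℝ] ℝ} (hu : HasWeakDifferential u θ) :
    sobolevENorm G (hausdorffVolume F) u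
      ≤ ENNReal.ofReal k * sobolevENorm G' (hausdorffVolume F) u :=
  hu.sobolevENorm_le_mul hF hG hG' hu (zero_le_one.trans hk)
    (fun x => hG'.polar_le_mul_polar hG (zero_le_one.trans hk) (hle x) (θ x))
    (fun x => by nlinarith [abs_nonneg (u x)])

/-- `W₀^{1,2}` is a reflexive Banach space under the Sobolev norm of any symmetric gauge that is
uniformly equivalent to `F`. -/
theorem isReflexiveBanachNorm_sobolevNorm (hF : IsGauge F) (hG : IsGauge G)
    (hsymm : ∀ (x : M) (y : TangentSpace (𝓡 n) x), G ⟨x, -y⟩ = G ⟨x, y⟩) {k A B : ℝ}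
    (hk : 1 ≤ k) (hrev : ∀ (x : M) (y : TangentSpace (𝓡 n) x), F ⟨x, -y⟩ ≤ k * F ⟨x, y⟩)
    (hA : 1 ≤ A) (hGF : ∀ (x : M) (y : TangentSpace (𝓡 n) x), G ⟨x, y⟩ ≤ A * F ⟨x, y⟩)
    (hB : 1 ≤ B) (hFG : ∀ (x : M) (y : TangentSpace (𝓡 n) x), F ⟨x, y⟩ ≤ B * G ⟨x, y⟩) :
    IsReflexiveBanachNorm (fun u : W12ZeroSubmodule hF hk hrev =>
      sobolevNorm G (hausdorffVolume F) u) := by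
  obtain ⟨Y, hY1, hYc, hYm⟩ := exists_adapted_frame (F := F) hG
  have hfin : ∀ u : W12ZeroSubmodule hF hk hrev, sobolevENorm G (hausdorffVolume F) u < ⊤ :=
    fun u => (sobolevENorm_le_of_gauge_le hF hG hF hB hFG
      (hasWeakDifferential_coeFn u.2)).trans_lt
      (ENNReal.mul_lt_top ENNReal.ofReal_lt_top (sobolevENorm_lt_top hF u.2))
  have hup : ∀ (u : M → ℝ) (θ : (x : M) → TangentSpace (𝓡 n) x →L[ℝ] ℝ),
      eLpNorm (jet Y u θ) 2 (hausdorffVolume F)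
        ≤ ENNReal.ofReal (n + 1) * eLpNorm (jetNorm G u θ) 2 (hausdorffVolume F) := fun u θ =>
    eLpNorm_le_mul_eLpNorm_of_ae_le_mul (Eventually.of_forall fun x => by
      rw [Real.norm_of_nonneg (jetNorm_nonneg x)]
      exact norm_jet_le hG hsymm hY1 x) 2
  have hlow : ∀ (u : M → ℝ) (θ : (x : M) → TangentSpace (𝓡 n) x →L[ℝ] ℝ),
      eLpNorm (jetNorm G u θ) 2 (hausdorffVolume F)
        ≤ ENNReal.ofReal (2 * n + 1) * eLpNorm (jet Y u θ) 2 (hausdorffVolume F) := fun u θ =>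
    eLpNorm_le_mul_eLpNorm_of_ae_le_mul (Eventually.of_forall fun x => by
      rw [Real.norm_of_nonneg (jetNorm_nonneg x)]
      exact jetNorm_le_norm_jet hG hYc x) 2
  have hsob : ∀ u : W12ZeroSubmodule hF hk hrev, sobolevENorm G (hausdorffVolume F) u
      = eLpNorm (jetNorm G u (weakDifferential (n := n) u)) 2 (hausdorffVolume F) := fun u =>
    (hasWeakDifferential_coeFn u.2).sobolevENorm_eq_self hF hG
  have hmem : ∀ u : W12ZeroSubmodule hF hk hrev,
      MemLp (jet Y u (weakDifferential (n := n) u)) 2 (hausdorffVolume F) := fun u =>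
    ⟨((hasWeakDifferential_coeFn u.2).aemeasurable_jet hYm).aestronglyMeasurable,
      (hup _ _).trans_lt (ENNReal.mul_lt_top ENNReal.ofReal_lt_top (hsob u ▸ hfin u))⟩
  -- Linearity holds only after passing to classes, as the chosen weak differentials are additive
  -- and homogeneous almost everywhere.
  let J : W12ZeroSubmodule hF hk hrev →ₗ[ℝ]
      Lp (EuclideanSpace ℝ (Option (Fin n))) 2 (hausdorffVolume F) :=
    { toFun := fun u => (hmem u).toLp _
      map_add' := fun u w => by
        rw [← MemLp.toLp_add]
        refine MemLp.toLp_congr _ _ ?_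
        refine (((hasWeakDifferential_coeFn u.2).add (hasWeakDifferential_coeFn w.2)).jet_ae_eq hF
          (AEEqFun.coeFn_add _ _).symm).trans (Eventually.of_forall fun x => jet_add x)
      map_smul' := fun c u => by
        rw [RingHom.id_apply, ← MemLp.toLp_const_smul]
        refine MemLp.toLp_congr _ _ ?_
        refine (((hasWeakDifferential_coeFn u.2).smul c).jet_ae_eq hF
          (AEEqFun.coeFn_smul c (u : M →ₘ[hausdorffVolume F] ℝ)).symm).trans
          (Eventually.of_forall fun x => jet_smul c x) }
  have hJ : ∀ u, J u =ᵐ[hausdorffVolume F] jet Y u (weakDifferential (n := n) u) := fun u =>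
    (hmem u).coeFn_toLp
  have hJn : ∀ u, ‖J u‖ = (eLpNorm (jet Y u (weakDifferential (n := n) u)) 2
      (hausdorffVolume F)).toReal := fun u => Lp.norm_toLp _ (hmem u)
  have hnn : (0 : ℝ) ≤ n := by positivity
  refine isReflexiveBanachNorm_of_embedding _ (fun u => ENNReal.toReal_nonneg) (fun c u => ?_)
    (fun u w => sobolevNorm_add_le hF hG u.2 w.2 (hfin u) (hfin w)) (fun u => ?_) J
    (n + 1 : NNReal) (2 * n + 1 : NNReal) (fun u => ?_) (fun u => ?_) ?_
  · rcases le_or_gt 0 c with hc | hc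
    · rw [abs_of_nonneg hc]
      exact sobolevNorm_smul_of_nonneg hF hG u.2 hc
    · rw [abs_of_neg hc, ← sobolevNorm_smul_of_nonneg hF hG u.2 (by linarith : 0 ≤ -c),
        ← sobolevNorm_neg_of_symm hF hG hsymm ((W12ZeroSubmodule hF hk hrev).smul_mem (-c) u.2)]
      simp
  · rw [sobolevNorm_eq_zero_iff hF hG u.2 (hfin u)]
    simp
  · have h := ENNReal.toReal_mono (ENNReal.mul_ne_top ENNReal.ofReal_ne_top (hsob u ▸ hfin u).ne)
      (hup u (weakDifferential (n := n) u))
    rw [ENNReal.toReal_mul, ENNReal.toReal_ofReal (by positivity), ← hsob, ← hJn] at h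
    simpa [sobolevNorm] using h
  · have h := ENNReal.toReal_mono (ENNReal.mul_ne_top ENNReal.ofReal_ne_top (hmem u).2.ne)
      (hlow u (weakDifferential (n := n) u))
    rw [ENNReal.toReal_mul, ENNReal.toReal_ofReal (by positivity), ← hsob, ← hJn] at h
    simpa [sobolevNorm] using h
  · refine IsSeqClosed.isClosed fun g f hg hgf => ?_
    choose v hv using hg
    have hlim : Tendsto (fun j => eLpNorm (fun x => jet Y (v j).1 (weakDifferential (n := n) (v j).1) x
        - f x) 2 (hausdorffVolume F)) atTop (𝓝 0) := by
      have h1 := (Lp.tendsto_Lp_iff_tendsto_eLpNorm' g f).1 hgf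
      refine h1.congr fun j => eLpNorm_congr_ae ?_
      filter_upwards [hJ (v j)] with x hx
      rw [Pi.sub_apply, ← hv j, hx]
    -- The limit f is itself read as a jet: its first component is the candidate u, the others
    -- prescribe the candidate differential α on the frame.
    choose α hα using fun x => exists_covector_of_frame
      (fun x y => (hYc x y).imp fun c hc => hc.1) x (fun i => f x (some i))
    set u : M → ℝ := fun x => f x none with hu
    have hjet : ∀ x, jet Y u α x = f x := fun x => by
      ext o
      cases o with
      | none => rfl
      | some i => exact hα x i
    have hsub : ∀ j x, jet Y (v j).1 (weakDifferential (n := n) (v j).1) x - f x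
        = jet Y (fun x => (v j).1 x - u x) (fun x => weakDifferential (n := n) (v j).1 x - α x) x := by
      intro j x
      rw [← hjet x]
      ext o; cases o <;> rfl
    simp only [hsub] at hlim
    have hlimN : Tendsto (fun j => eLpNorm (jetNorm G (fun x => (v j).1 x - u x)
        (fun x => weakDifferential (n := n) (v j).1 x - α x)) 2 (hausdorffVolume F)) atTop (𝓝 0) :=
      tendsto_of_tendsto_of_tendsto_of_le_of_le tendsto_const_nhds
        (by simpa using ENNReal.Tendsto.const_mul hlim (Or.inr ENNReal.ofReal_ne_top))
        (fun j => zero_le) (fun j => hlow _ _)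
    have hum : AEMeasurable u (hausdorffVolume F) :=
      (EuclideanSpace.proj (𝕜 := ℝ) (none : Option (Fin n))).continuous.measurable.comp_aemeasurable
        (Lp.aestronglyMeasurable f).aemeasurable
    have hαm : AEMeasurableCovector α := by
      -- Along a subsequence the jets converge almost everywhere. The frame coefficients of a vector
      -- do not depend on the sequence index, so the covectors converge pointwise and measurability
      -- passes to α.
      obtain ⟨s, -, hs⟩ := (tendstoInMeasure_of_tendsto_Lp hgf).exists_seq_tendsto_ae
      refine AEMeasurableCovector.of_tendsto hF
        (θk := fun j => weakDifferential (n := n) (v (s j)).1)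
        (fun j => (hasWeakDifferential_coeFn (v (s j)).2).aemeasurableCovector) ?_
      filter_upwards [hs, ae_all_iff.2 fun j => hJ (v j)] with x hx hxJ y
      obtain ⟨c, hc, -⟩ := hYc x y
      have hexp : ∀ β : TangentSpace (𝓡 n) x →L[ℝ] ℝ, β y = ∑ i, c i * β (Y i x) := fun β => by
        conv_lhs => rw [hc, map_sum]
        simp
      simp only [hexp]
      refine tendsto_finsetSum _ fun i _ => Tendsto.const_mul _ ?_
      rw [hα x i]
      have h2 := ((EuclideanSpace.proj (𝕜 := ℝ) (some i : Option (Fin n))).continuous.tendsto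
        (f x)).comp hx
      refine h2.congr fun j => ?_
      change g (s j) x (some i) = _
      rw [← hv, hxJ, jet_some]
    have hd : HasWeakDifferential u α := by
      refine HasWeakDifferential.of_tendsto hF hG hsymm
        (fun j => hasWeakDifferential_coeFn (v j).2) hum hαm ?_ ?_
      · refine tendsto_of_tendsto_of_tendsto_of_le_of_le tendsto_const_nhds hlimN
          (fun j => zero_le) fun j => ?_
        exact eLpNorm_mono_real fun x => abs_le_jetNorm (u := fun x => (v j).1 x - u x) x
      · refine tendsto_of_tendsto_of_tendsto_of_le_of_le tendsto_const_nhds hlimN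
          (fun j => zero_le) fun j => ?_
        refine eLpNorm_mono_real fun x => ?_
        exact Real.abs_le_sqrt (by nlinarith [sq_nonneg ((v j).1 x - u x)])
    have hFle : ∀ {w : M → ℝ} {η : (x : M) → TangentSpace (𝓡 n) x →L[ℝ] ℝ},
        HasWeakDifferential w η → sobolevENorm F (hausdorffVolume F) w
          ≤ ENNReal.ofReal A * eLpNorm (jetNorm G w η) 2 (hausdorffVolume F) := fun hw =>
      hw.sobolevENorm_eq_self hF hG ▸ sobolevENorm_le_of_gauge_le hF hF hG hA hGF hw
    have hdsub : ∀ j, HasWeakDifferential (fun x => (v j).1 x - u x)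
        (fun x => weakDifferential (n := n) (v j).1 x - α x) := fun j => by
      have h1 := (hasWeakDifferential_coeFn (v j).2).add (hd.smul (-1))
      have h2 : (fun x => weakDifferential (n := n) (v j).1 x - α x)
          = fun x => weakDifferential (n := n) (v j).1 x + (-1 : ℝ) • α x := by
        ext x y
        change weakDifferential (n := n) (v j).1 x y - α x y
          = weakDifferential (n := n) (v j).1 x y + -1 * α x y
        ring
      rw [h2]
      simpa only [neg_one_mul, ← sub_eq_add_neg] using h1
    have hW : AEEqFun.mk u hum.aestronglyMeasurable ∈ W12Zero F (hausdorffVolume F) := by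
      refine mem_W12Zero_of_ae_eq hF hd (AEEqFun.coeFn_mk u _).symm ?_ fun ε hε => ?_
      · refine (hFle hd).trans_lt (ENNReal.mul_lt_top ENNReal.ofReal_lt_top
          ((hlow u α).trans_lt (ENNReal.mul_lt_top ENNReal.ofReal_lt_top ?_)))
        rw [funext hjet]
        exact Lp.eLpNorm_lt_top f
      · have hlimF : Tendsto (fun j => sobolevENorm F (hausdorffVolume F) (fun x => (v j).1 x - u x))
            atTop (𝓝 0) :=
          tendsto_of_tendsto_of_tendsto_of_le_of_le tendsto_const_nhds
            (by simpa using ENNReal.Tendsto.const_mul hlimN (Or.inr ENNReal.ofReal_ne_top))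
            (fun j => zero_le) (fun j => hFle (hdsub j))
        obtain ⟨j, hj⟩ := (hlimF.eventually (gt_mem_nhds (ENNReal.half_pos hε.ne'))).exists
        obtain ⟨φ, hφ, hφc, hlt⟩ := (v j).2.2 (ε / 2) (ENNReal.half_pos hε.ne')
        refine ⟨φ, hφ, hφc, ?_⟩
        have h1 := (hasWeakDifferential_sub_coeFn (v j).2 hφ).sobolevENorm_add_le hF hF (hdsub j)
        -- The order of the differences matters, because the norm of F is not symmetric.
        have h2 : (fun x => φ x - u x) = fun x => φ x - (v j).1 x + ((v j).1 x - u x) := by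
          ext x; ring
        rw [h2]
        exact h1.trans_lt ((ENNReal.add_lt_add hlt hj).trans_eq (ENNReal.add_halves ε))
    refine ⟨⟨AEEqFun.mk u hum.aestronglyMeasurable, hW⟩, Lp.ext ?_⟩
    refine (hJ _).trans ((hd.jet_ae_eq hF (AEEqFun.coeFn_mk u _).symm).trans ?_)
    exact Eventually.of_forall hjet

end Reflexive

/-! ### Pointwise comparison of F and F_s -/

section Reversibility

variable [IsManifold (𝓡 n) ∞ M] {F : TangentBundle (𝓡 n) M → ℝ}

theorem IsGauge.neg_le_reversibility_mul (hF : IsGauge F) (hr : reversibility F < ⊤) (x : M)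
    (y : TangentSpace (𝓡 n) x) : F ⟨x, -y⟩ ≤ (reversibility F).toReal * F ⟨x, y⟩ := by
  rcases eq_or_ne y 0 with rfl | hy
  · rw [neg_zero, hF.zero, mul_zero]
  have h : ENNReal.ofReal (F ⟨x, -y⟩ / F ⟨x, - -y⟩) ≤ reversibility F :=
    le_iSup₂_of_le x (-y) (le_iSup_of_le (neg_ne_zero.2 hy) le_rfl)
  rw [neg_neg, ENNReal.ofReal_le_iff_le_toReal hr.ne, div_le_iff₀ (hF.pos x y hy)] at h
  exact h

/-- Applying F(-y) ≤ r F(y) to a nonzero y and to its opposite excludes r < 1. Such a y exists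
because n ≥ 1; in dimension 0 the supremum would be 0. -/
theorem IsGauge.one_le_reversibility (hF : IsGauge F) (hn : 1 ≤ n) [Nonempty M]
    (hr : reversibility F < ⊤) : 1 ≤ (reversibility F).toReal := by
  obtain ⟨x⟩ := ‹Nonempty M›
  have : Nonempty (Fin n) := ⟨⟨0, hn⟩⟩
  obtain ⟨y, hy⟩ := exists_ne (0 : EuclideanSpace ℝ (Fin n))
  let z : TangentSpace (𝓡 n) x := y
  have h1 := hF.neg_le_reversibility_mul hr x z
  have h2 := hF.neg_le_reversibility_mul hr x (-z)
  rw [neg_neg] at h2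
  have h3 := hF.pos x z hy
  have h4 := hF.nonneg x (-z)
  by_contra! h5
  nlinarith [mul_pos (sub_pos.2 h5) h3, mul_nonneg (sub_pos.2 h5).le h4]

theorem symmetrized_le_mul (hF : IsGauge F) {r : ℝ}
    (hrev : ∀ (x : M) (y : TangentSpace (𝓡 n) x), F ⟨x, -y⟩ ≤ r * F ⟨x, y⟩) (x : M)
    (y : TangentSpace (𝓡 n) x) :
    symmetrized F ⟨x, y⟩ ≤ ((1 + r ^ 2) / 2) ^ (1 / 2 : ℝ) * F ⟨x, y⟩ := by
  have h1 := hF.nonneg x y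
  rw [← Real.sqrt_eq_rpow]
  refine Real.sqrt_le_iff.2 ⟨by positivity, ?_⟩
  rw [mul_pow, Real.sq_sqrt (by positivity)]
  have h2 := pow_le_pow_left₀ (hF.nonneg x (-y)) (hrev x y) 2
  rw [mul_pow] at h2
  change (F ⟨x, y⟩ ^ 2 + F ⟨x, -y⟩ ^ 2) / 2 ≤ _
  linarith

/-- The reversibility bound at -y reads F(-y) ≥ r⁻¹ F(y), so F_s² ≥ (1 + r⁻²)/2 · F². -/
theorem le_mul_symmetrized (hF : IsGauge F) {r : ℝ} (hr : 0 < r)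
    (hrev : ∀ (x : M) (y : TangentSpace (𝓡 n) x), F ⟨x, -y⟩ ≤ r * F ⟨x, y⟩) (x : M)
    (y : TangentSpace (𝓡 n) x) :
    F ⟨x, y⟩ ≤ ((1 + r ^ (-2 : ℤ)) / 2) ^ (-(1 / 2) : ℝ) * symmetrized F ⟨x, y⟩ := by
  have h1 := hF.nonneg x y
  rw [Real.rpow_neg (by positivity), ← Real.sqrt_eq_rpow,
    le_inv_mul_iff₀ (Real.sqrt_pos.2 (by positivity))]
  refine Real.le_sqrt_of_sq_le ?_
  rw [mul_pow, Real.sq_sqrt (by positivity)]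
  have h2 := hrev x (-y)
  rw [neg_neg, ← inv_mul_le_iff₀ hr] at h2
  have h3 := pow_le_pow_left₀ (by positivity) h2 2
  rw [mul_pow] at h3
  rw [zpow_neg, zpow_ofNat, ← inv_pow]
  change _ ≤ (F ⟨x, y⟩ ^ 2 + F ⟨x, -y⟩ ^ 2) / 2
  linarith

end Reversibility

end Finsler

end

/-! ### Assembly of the main theorem -/

theorem theorem1p1 {n : ℕ} (hn : 1 ≤ n) {M : Type*} [TopologicalSpace M] [T2Space M]
    [SecondCountableTopology M] [ConnectedSpace M] [MeasurableSpace M] [BorelSpace M]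
    [ChartedSpace (EuclideanSpace ℝ (Fin n)) M] [IsManifold (𝓡 n) ∞ M]
    (F : TangentBundle (𝓡 n) M → ℝ) (hF : Finsler.IsFinslerMetric F)
    (hforward : Finsler.IsForwardComplete F) (hbackward : Finsler.IsBackwardComplete F)
    (hr : Finsler.reversibility F < ⊤) :
    ∃ W : Submodule ℝ (M →ₘ[Finsler.hausdorffVolume F] ℝ),
      (W : Set (M →ₘ[Finsler.hausdorffVolume F] ℝ))
          = Finsler.W12Zero F (Finsler.hausdorffVolume F) ∧
      Finsler.IsReflexiveBanachNorm (fun u : W =>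
        Finsler.sobolevNorm (Finsler.symmetrized F) (Finsler.hausdorffVolume F) u) ∧
      Finsler.IsAsymmetricNorm (fun u : W =>
        Finsler.sobolevNorm F (Finsler.hausdorffVolume F) u) ∧
      ∀ u ∈ W,
        Finsler.sobolevENorm F (Finsler.hausdorffVolume F) u < ⊤ ∧
        Finsler.sobolevENorm (Finsler.symmetrized F) (Finsler.hausdorffVolume F) u < ⊤ ∧
        ((1 + (Finsler.reversibility F).toReal ^ 2) / 2) ^ (-(1 / 2) : ℝ)
            * Finsler.sobolevNorm F (Finsler.hausdorffVolume F) u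
          ≤ Finsler.sobolevNorm (Finsler.symmetrized F) (Finsler.hausdorffVolume F) u ∧
        Finsler.sobolevNorm (Finsler.symmetrized F) (Finsler.hausdorffVolume F) u
          ≤ ((1 + (Finsler.reversibility F).toReal ^ (-2 : ℤ)) / 2) ^ (-(1 / 2) : ℝ)
            * Finsler.sobolevNorm F (Finsler.hausdorffVolume F) u := by
  have hG := hF.isGauge
  have hS := hG.symmetrized
  have hrev := hG.neg_le_reversibility_mul hr
  have hr1 := hG.one_le_reversibility hn hr
  set r := (Finsler.reversibility F).toReal
  have hA : 1 ≤ ((1 + r ^ 2) / 2) ^ (1 / 2 : ℝ) :=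
    Real.one_le_rpow (by nlinarith) (by norm_num)
  have hB : 1 ≤ ((1 + r ^ (-2 : ℤ)) / 2) ^ (-(1 / 2) : ℝ) := by
    have h : r ^ (-2 : ℤ) ≤ 1 := by
      rw [zpow_neg, zpow_ofNat]
      exact inv_le_one_of_one_le₀ (one_le_pow₀ hr1)
    exact Real.one_le_rpow_of_pos_of_le_one_of_nonpos (by positivity) (by linarith) (by norm_num)
  have hSF := Finsler.symmetrized_le_mul hG hrev
  have hFS := Finsler.le_mul_symmetrized hG (zero_lt_one.trans_le hr1) hrev
  refine ⟨Finsler.W12ZeroSubmodule hG hr1 hrev, rfl,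
    Finsler.isReflexiveBanachNorm_sobolevNorm hG hS Finsler.symmetrized_neg hr1 hrev hA hSF hB hFS,
    ⟨fun u => ENNReal.toReal_nonneg, fun u => ?_,
      fun c u hc => Finsler.sobolevNorm_smul_of_nonneg hG hG u.2 hc,
      fun u w => Finsler.sobolevNorm_add_le hG hG u.2 w.2 (Finsler.sobolevENorm_lt_top hG u.2)
        (Finsler.sobolevENorm_lt_top hG w.2)⟩, fun u hu => ?_⟩
  · rw [Finsler.sobolevNorm_eq_zero_iff hG hG u.2 (Finsler.sobolevENorm_lt_top hG u.2),
      Submodule.coe_eq_zero]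
  have hd := Finsler.hasWeakDifferential_coeFn hu
  have hFfin := Finsler.sobolevENorm_lt_top hG hu
  have h1 := Finsler.sobolevENorm_le_of_gauge_le hG hG hS hA hSF hd
  have h2 := Finsler.sobolevENorm_le_of_gauge_le hG hS hG hB hFS hd
  have hSfin := h2.trans_lt (ENNReal.mul_lt_top ENNReal.ofReal_lt_top hFfin)
  have h1' := ENNReal.toReal_mono (ENNReal.mul_ne_top ENNReal.ofReal_ne_top hSfin.ne) h1
  have h2' := ENNReal.toReal_mono (ENNReal.mul_ne_top ENNReal.ofReal_ne_top hFfin.ne) h2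
  rw [ENNReal.toReal_mul, ENNReal.toReal_ofReal (by positivity)] at h1' h2'
  refine ⟨hFfin, hSfin, ?_, h2'⟩
  -- F_s ≤ A F gives ‖u‖_F ≤ A ‖u‖_{F_s}; dividing by A is the lower bound.
  rw [Real.rpow_neg (by positivity), inv_mul_le_iff₀ (by positivity)]
  exact h1'
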